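/- Let $N,d$ be integers, let $A\in\mathbb{R}^{N\times N}$ and $B\in\mathbb{R}^{N\times d}$ with $\operatorname{rank}(B)=d$, and assume the Kalman condition $\operatorname{rank}[B,AB,\dots,A^{N-1}B]=N$. Let $n:=\min\{r\ge 1:\operatorname{rank}[B,AB,\dots,A^{r-1}B]=N\}$, let $V_0:=\{0\}$ and $V_h:=\sum_{k=1}^{h}\operatorname{Im}(A^{k-1}B)$, let $E_h$ be the orthogonal projection of $\mathbb{R}^N$ onto $V_{h-1}^{\perp}\cap V_h$ for $1\le h\le n$, and set $$\mathbb{M}_t:=\sum_{h=1}^{n}t^{h-1}E_h,$$ that is, $\mathbb{M}_t=\operatorname{diag}(I,tI,\dots,t^{n-1}I)$ with respect to the orthogonal decomposition $\mathbb{R}^N=\bigoplus_{h=1}^nE_h(\mathbb{R}^N)$. A Lévy measure on $\mathbb{R}^m$ is a Borel measure $\nu$ on $\mathbb{R}^m\setminus\{0\}$ with $\int(1\wedge|z|^2)\,\nu(dz)<\infty$. For $\alpha\in(0,2)$, $\nu$ satisfies condition [ND] on $\mathbb{R}^m$ with exponent $\alpha$ if there are $r_0>0$ and a finite measure $\mu$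 on the unit sphere $\mathbb{S}^{m-1}$ which is non-degenerate (there is $\eta\ge1$ with $\eta^{-1}|p|^\alpha\le\int_{\mathbb{S}^{m-1}}|p\cdot s|^\alpha\mu(ds)\le\eta|p|^\alpha$ for all $p\in\mathbb{R}^m$) such that $$\nu(C)\ \ge\ \int_0^{r_0}\int_{\mathbb{S}^{m-1}}\mathbf{1}_C(r\theta)\,\mu(d\theta)\,\frac{dr}{r^{1+\alpha}}\qquad\text{for all Borel }C\subseteq\mathbb{R}^m\setminus\{0\}.$$ A Lévy process on $\mathbb{R}^m$ is a stochastically continuous process with independent and stationary increments that starts at $0$ almost surely; it has Lévy triplet $(Q,b,\nu)$, where $Q$ is symmetric and non-negative definite, $b\in\mathbb{R}^m$ and $\nu$ is a Lévy measure, if its characteristic function at time $u\ge 0$ is $e^{-u\Phi}$ with $$\Phi(p)=-ib\cdot p+\tfrac12\,p\cdot Qp+\int\bigl(1-e^{ip\cdot z}+ip\cdot z\,\mathbf{1}_{B(0,1)}(z)\bigr)\nu(dz).$$ Let $Z$ be a Lévy process on $\mathbb{R}^d$ with Lévy triplet $(Q,b,\nu)$, where $\nu$ satisfies [ND] on $\mathbb{R}^d$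 with exponent $\alpha\in(0,2)$. For $x\in\mathbb{R}^N$, the Ornstein–Uhlenbeck process started at $x$ is the càdlàg process $X$ such that, almost surely, $X_t=x+\int_0^tAX_s\,ds+BZ_t$ for all $t\ge0$. Then for every $t\in(0,1]$ there is a Lévy process $\{S^t_u\}_{u\ge0}$ on $\mathbb{R}^N$ (on some probability space), not depending on $x$, such that the Lévy measure of $S^t$ satisfies [ND] on $\mathbb{R}^N$ with the same exponent $\alpha$ and, for every $x\in\mathbb{R}^N$, the Ornstein–Uhlenbeck process $X$ started at $x$ satisfies $$X_t\ \overset{\text{law}}{=}\ e^{tA}x+\mathbb{M}_tS^t_t.$$ -/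

import Mathlib

open MeasureTheory ProbabilityTheory Filter Topology Set
open scoped NNReal ENNReal

noncomputable section

/-! ### The matrices of the model -/

/-- The matrix `[B, AB, …, A^{r-1}B]` with `N` rows and `r * d` columns; the column indexed by
`(k, j)` is the `j`-th column of `A ^ k * B`. -/
def kalmanMatrix {N d : ℕ} (A : Matrix (Fin N) (Fin N) ℝ) (B : Matrix (Fin N) (Fin d) ℝ) (r : ℕ) :
    Matrix (Fin N) (Fin r × Fin d) ℝ :=
  Matrix.of fun i kj => (A ^ (kj.1 : ℕ) * B) i kj.2

/-- The Kalman condition `N = rank [B, AB, …, A^{N-1}B]`. -/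
def KalmanCondition {N d : ℕ} (A : Matrix (Fin N) (Fin N) ℝ) (B : Matrix (Fin N) (Fin d) ℝ) :
    Prop :=
  (kalmanMatrix A B N).rank = N

/-- `n = min {r ≥ 1 : N = rank [B, AB, …, A^{r-1}B]}`. -/
def kalmanIndex {N d : ℕ} (A : Matrix (Fin N) (Fin N) ℝ) (B : Matrix (Fin N) (Fin d) ℝ) : ℕ :=
  sInf {r : ℕ | 1 ≤ r ∧ (kalmanMatrix A B r).rank = N}

/-- `V_h = Im B + Im (AB) + … + Im (A^{h-1}B)`, with `V_0 = 0`. -/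
def kalmanSpace {N d : ℕ} (A : Matrix (Fin N) (Fin N) ℝ) (B : Matrix (Fin N) (Fin d) ℝ) (h : ℕ) :
    Submodule ℝ (EuclideanSpace ℝ (Fin N)) :=
  ⨆ k ∈ Finset.range h, LinearMap.range (Matrix.toEuclideanLin (A ^ k * B))

/-- `E_{h+1}`: the orthogonal projection of `ℝ^N` onto `(V_h)^⊥ ∩ V_{h+1}`.
For `h = 0` this is the orthogonal projection onto `V_1 = Im B`. -/
def layerProjection {N d : ℕ} (A : Matrix (Fin N) (Fin N) ℝ) (B : Matrix (Fin N) (Fin d) ℝ)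
    (h : ℕ) : EuclideanSpace ℝ (Fin N) →L[ℝ] EuclideanSpace ℝ (Fin N) :=
  ((kalmanSpace A B h)ᗮ ⊓ kalmanSpace A B (h + 1)).starProjection

/-- `M_t = ∑_{h=1}^n t^{h-1} E_h`, that is, `diag (I, t I, …, t^{n-1} I)` with respect to the
orthogonal decomposition `ℝ^N = E_1(ℝ^N) ⊕ … ⊕ E_n(ℝ^N)`. -/
def scalingMap {N d : ℕ} (A : Matrix (Fin N) (Fin N) ℝ) (B : Matrix (Fin N) (Fin d) ℝ) (t : ℝ) :
    EuclideanSpace ℝ (Fin N) →L[ℝ] EuclideanSpace ℝ (Fin N) :=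
  ∑ h ∈ Finset.range (kalmanIndex A B), t ^ h • layerProjection A B h

/-! ### Lévy measures and the non-degeneracy condition -/

/-- A Lévy measure on `ℝ^m ∖ {0}`, seen as a Borel measure on `ℝ^m` that does not charge `0`. -/
structure IsLevyMeasure {m : ℕ} (ν : Measure (EuclideanSpace ℝ (Fin m))) : Prop where
  zero : ν {0} = 0
  lintegral_lt_top : ∫⁻ z, ENNReal.ofReal (min 1 (‖z‖ ^ 2)) ∂ν < ∞

/-- A measure `μ` on the unit sphere of `ℝ^m` is non-degenerate (with exponent `α`) if
`η⁻¹ |p|^α ≤ ∫ |p · s|^α μ(ds) ≤ η |p|^α` for some `η ≥ 1` and all `p`. -/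
def IsNondegenerateOnSphere {m : ℕ} (α : ℝ)
    (μ : Measure (Metric.sphere (0 : EuclideanSpace ℝ (Fin m)) 1)) : Prop :=
  ∃ η : ℝ, 1 ≤ η ∧ ∀ p : EuclideanSpace ℝ (Fin m),
    η⁻¹ * ‖p‖ ^ α ≤ ∫ s, |inner ℝ p (s : EuclideanSpace ℝ (Fin m))| ^ α ∂μ ∧
    ∫ s, |inner ℝ p (s : EuclideanSpace ℝ (Fin m))| ^ α ∂μ ≤ η * ‖p‖ ^ α

/-- Condition [ND] with exponent `α`: the measure `ν` dominates the polar measure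
`1_{(0, r₀]}(r) r^{-(1+α)} dr μ(dθ)` for some `r₀ > 0` and some finite non-degenerate measure `μ`
on the unit sphere. -/
def ConditionND {m : ℕ} (α : ℝ) (ν : Measure (EuclideanSpace ℝ (Fin m))) : Prop :=
  ∃ r₀ : ℝ, 0 < r₀ ∧ ∃ μ : Measure (Metric.sphere (0 : EuclideanSpace ℝ (Fin m)) 1),
    IsFiniteMeasure μ ∧ IsNondegenerateOnSphere α μ ∧
    ∀ C : Set (EuclideanSpace ℝ (Fin m)), MeasurableSet C → 0 ∉ C →
      ∫⁻ r in Ioc (0 : ℝ) r₀,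
        (∫⁻ θ, C.indicator (fun _ => (1 : ℝ≥0∞)) (r • (θ : EuclideanSpace ℝ (Fin m))) ∂μ) *
          ENNReal.ofReal (1 / r ^ (1 + α)) ≤ ν C

/-! ### Lévy processes and the Ornstein-Uhlenbeck process -/

/-- The Lévy symbol of the triplet `(Q, b, ν)`:
`Φ(p) = - i b·p + (1/2) p·Qp + ∫ (1 - e^{i p·z} + i p·z 1_{B(0,1)}(z)) ν(dz)`. -/
def levySymbol {m : ℕ} (Q : Matrix (Fin m) (Fin m) ℝ) (b : EuclideanSpace ℝ (Fin m))
    (ν : Measure (EuclideanSpace ℝ (Fin m))) (p : EuclideanSpace ℝ (Fin m)) : ℂ :=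
  -Complex.I * (inner ℝ b p : ℝ) + (1 / 2 : ℂ) * (inner ℝ p (Matrix.toEuclideanLin Q p) : ℝ) +
    ∫ z, (1 - Complex.exp (Complex.I * (inner ℝ p z : ℝ)) +
      Complex.I * ((Metric.ball (0 : EuclideanSpace ℝ (Fin m)) 1).indicator
        (fun z => inner ℝ p z) z : ℝ)) ∂ν

/-- A Lévy process: it starts at `0` almost surely, has independent and stationary increments and
is stochastically continuous. -/
structure IsLevyProcess {m : ℕ} {Ω : Type*} [MeasurableSpace Ω] (P : Measure Ω)
    (Z : ℝ≥0 → Ω → EuclideanSpace ℝ (Fin m)) : Prop where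
  measurable : ∀ u, Measurable (Z u)
  zero : ∀ᵐ ω ∂P, Z 0 ω = 0
  indep_increments : HasIndepIncrements Z P
  stationary_increments : ∀ u v : ℝ≥0, IdentDistrib (fun ω => Z (u + v) ω - Z u ω) (Z v) P P
  stoch_continuous : ∀ u, TendstoInMeasure P Z (𝓝 u) (Z u)

/-- `Z` is a Lévy process with Lévy triplet `(Q, b, ν)`, i.e. with Lévy symbol `Φ` given by
`levySymbol Q b ν`: the characteristic function of `Z u` is `exp (-u Φ)`. -/
structure IsLevyProcessWithTriplet {m : ℕ} {Ω : Type*} [MeasurableSpace Ω] (P : Measure Ω)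
    (Z : ℝ≥0 → Ω → EuclideanSpace ℝ (Fin m)) (Q : Matrix (Fin m) (Fin m) ℝ)
    (b : EuclideanSpace ℝ (Fin m)) (ν : Measure (EuclideanSpace ℝ (Fin m))) : Prop where
  isLevyProcess : IsLevyProcess P Z
  posSemidef : Q.PosSemidef
  isLevyMeasure : IsLevyMeasure ν
  charFun_eq : ∀ (u : ℝ≥0) (p : EuclideanSpace ℝ (Fin m)),
    charFun (P.map (Z u)) p = Complex.exp (-((u : ℝ) : ℂ) * levySymbol Q b ν p)

/-- Right-continuous with left limits. -/
def IsCadlagPath {m : ℕ} (f : ℝ≥0 → EuclideanSpace ℝ (Fin m)) : Prop :=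
  ∀ t, ContinuousWithinAt f (Ici t) t ∧ ∃ l, Tendsto f (𝓝[<] t) (𝓝 l)

/-- `X` is the Ornstein-Uhlenbeck process started at `x` and driven by `B Z`, i.e. the (unique up
to indistinguishability) càdlàg process with
`X_t = x + ∫_0^t A X_s ds + B Z_t` for all `t ≥ 0`, almost surely. -/
structure IsOUProcess {N d : ℕ} {Ω : Type*} [MeasurableSpace Ω] (P : Measure Ω)
    (A : Matrix (Fin N) (Fin N) ℝ) (B : Matrix (Fin N) (Fin d) ℝ)
    (Z : ℝ≥0 → Ω → EuclideanSpace ℝ (Fin d)) (x : EuclideanSpace ℝ (Fin N))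
    (X : ℝ≥0 → Ω → EuclideanSpace ℝ (Fin N)) : Prop where
  measurable : ∀ t, Measurable (X t)
  cadlag : ∀ᵐ ω ∂P, IsCadlagPath fun t => X t ω
  integrable : ∀ᵐ ω ∂P, ∀ t : ℝ≥0,
    IntervalIntegrable (fun s : ℝ => Matrix.toEuclideanLin A (X s.toNNReal ω)) volume 0 t
  equation : ∀ᵐ ω ∂P, ∀ t : ℝ≥0,
    X t ω = x + (∫ s in (0 : ℝ)..t, Matrix.toEuclideanLin A (X s.toNNReal ω)) +
      Matrix.toEuclideanLin B (Z t ω)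

end

/-! Variation of constants gives `X_t = e^{tA}x + ∫₀ᵗ e^{(t-s)A} B dZ_s`. Let `T` be the inverse of
`M_t` and `L r = T e^{t(1-r)A} B` (`ouKernel`). If `Φ` is the symbol of `Z`, then `T` applied to the
stochastic integral has characteristic function `exp(-t Ψ)`, where `Ψ(p) = ∫₀¹ Φ((L r)ᵀ p) dr`. A
Lévy process `S` with symbol `Ψ` is therefore what is wanted. Of `M_t`, only invertibility is used.

No stochastic integral is needed. Riemann sums of `∫ L dZ` have explicit characteristic functions by
independence and stationarity of the increments, and they serve twice. Over `[0, u]` their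
characteristic functions converge to `exp(-u Ψ)`, which is thus a characteristic function
(`exists_charFun_eq_of_tendsto`); Kolmogorov extension then yields the process
(`exists_isLevyProcess`, `IsLevyProcessWithTriplet.exists_mixed`). Over `[0, t]`, summation by parts
along a càdlàg path shows that they converge almost surely to `X_t - e^{tA}x` once `M_t` is applied
(`IsCadlagPath.tendsto_sum_increments`), which identifies the law (`IsOUProcess.identDistrib`).

`Ψ` comes from a triplet whose Lévy measure is the image of `dr ⊗ ν` under `(r, z) ↦ L r z`;
changing the truncation only alters the drift (`integral_levySymbol_adjoint`). For [ND]
(`ConditionND.mixedMeasure`), each `L r` sends rays to rays, so the polar minorant of `ν` becomes a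
polar minorant whose spherical part is the image of `‖L r θ‖^α dr μ(dθ)` under normalisation. Its
`α`-moment in direction `p` is `∫∫ |(L r)ᵀ p · θ|^α μ(dθ) dr`, comparable to `∫ ‖(L r)ᵀ p‖^α dr`.
This is positive for `p ≠ 0` by the Kalman condition (`eq_zero_of_inner_exp_eq_zero`), and
compactness of the sphere makes the bound uniform in `p`. -/

noncomputable section

/-! ### The Kolmogorov extension theorem -/

section Kolmogorov

variable {ι E : Type*}

/-- Cylinders over compact sets with the finite intersection property have a common point. -/
lemma nonempty_iInter_cylinder_of_isCompact [TopologicalSpace E] [T2Space E] [Nonempty E]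
    (I : ℕ → Finset ι) (K : ∀ n, Set (I n → E)) (hK : ∀ n, IsCompact (K n))
    (h : ∀ n, (⋂ k ≤ n, cylinder (α := fun _ => E) (I k) (K k)).Nonempty) :
    (⋂ n, cylinder (α := fun _ => E) (I n) (K n)).Nonempty := by
  classical
  choose x hx using h
  have hx' : ∀ k n, k ≤ n → (fun i : I k => x n i) ∈ K k := fun k n hkn => by
    have := mem_iInter₂.1 (hx n) k hkn
    exact (mem_cylinder _ _ _).1 this
  -- Limits along a free ultrafilter replace a diagonal extraction of subsequences.
  let U : Ultrafilter ℕ := hyperfilter ℕ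
  have hU : ∀ k, ∀ᶠ n in (U : Filter ℕ), k ≤ n := fun k =>
    Nat.hyperfilter_le_atTop (eventually_ge_atTop k)
  have hy : ∀ k, ∃ y ∈ K k, Tendsto (fun n => fun i : I k => x n i) U (𝓝 y) := fun k => by
    obtain ⟨y, hy, hy'⟩ := (hK k).ultrafilter_le_nhds (U.map fun n => fun i : I k => x n i)
      (by
        rw [le_principal_iff]
        exact (hU k).mono fun n hn => hx' k n hn)
    exact ⟨y, hy, hy'⟩
  -- Coordinates outside every `I k` are unconstrained, so any value may be taken where the limit
  -- does not exist.
  let l : ι → E := fun i =>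
    if h : ∃ e, Tendsto (fun n => x n i) U (𝓝 e) then h.choose else Classical.arbitrary E
  have hl : ∀ k (i : I k), Tendsto (fun n => x n i) U (𝓝 (l i)) := fun k i => by
    obtain ⟨y, -, hy⟩ := hy k
    have h : ∃ e, Tendsto (fun n => x n i) U (𝓝 e) := ⟨y i, (tendsto_pi_nhds.1 hy) i⟩
    simp only [l, dif_pos h]
    exact h.choose_spec
  refine ⟨l, mem_iInter.2 fun k => ?_⟩
  rw [mem_cylinder]
  exact (hK k).isClosed.mem_of_tendsto (tendsto_pi_nhds.2 fun i => hl k i)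
    ((hU k).mono fun n hn => hx' k n hn)

variable [TopologicalSpace E] [PolishSpace E] [MeasurableSpace E] [BorelSpace E] [Nonempty E]
  {P : ∀ J : Finset ι, Measure (J → E)} [∀ J, IsFiniteMeasure (P J)]

/-- The content of a projective family of finite measures on Polish spaces is continuous at `∅`. -/
lemma tendsto_projectiveFamilyContent_zero
    (hP : IsProjectiveMeasureFamily (α := fun _ : ι => E) P) {A : ℕ → Set (ι → E)}
    (hA : ∀ n, A n ∈ measurableCylinders fun _ : ι => E) (hanti : Antitone A)
    (hempty : ⋂ n, A n = ∅) :
    Tendsto (fun n => projectiveFamilyContent hP (A n)) atTop (𝓝 0) := by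
  have hanti' : Antitone fun n => projectiveFamilyContent hP (A n) := fun m n hmn =>
    projectiveFamilyContent_mono hP (hA n) (hA m) (hanti hmn)
  have hlim := tendsto_atTop_iInf hanti'
  by_contra hne
  have hpos : 0 < ⨅ n, projectiveFamilyContent hP (A n) := by
    rw [pos_iff_ne_zero]
    intro h0
    rw [h0] at hlim
    exact hne hlim
  set ε : ℝ≥0∞ := ⨅ n, projectiveFamilyContent hP (A n) with hε
  -- Inner regularity will cost `δ n` at stage `n`; the total loss stays below the supposed limit
  -- `ε`, so the compact cylinders still meet.
  obtain ⟨δ, hδ, hδsum⟩ := ENNReal.exists_pos_sum_of_countable' hpos.ne' ℕ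
  choose I S hS hAS using fun n => (mem_measurableCylinders _).1 (hA n)
  have hK : ∀ n, ∃ K ⊆ S n, IsCompact K ∧ P (I n) (S n \ K) < δ n := fun n =>
    (hS n).exists_isCompact_sdiff_lt (measure_ne_top _ _) (hδ n).ne'
  choose K hKS hKc hKδ using hK
  have hKm : ∀ n, MeasurableSet (K n) := fun n => (hKc n).isClosed.measurableSet
  have hne : ∀ n, (⋂ k ≤ n, cylinder (α := fun _ => E) (I k) (K k)).Nonempty := by
    intro n
    by_contra hcon
    rw [not_nonempty_iff_eq_empty] at hcon
    have hcover : A n ⊆ ⋃ k ≤ n, cylinder (α := fun _ => E) (I k) (S k \ K k) := by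
      intro a ha
      have : a ∉ ⋂ k ≤ n, cylinder (α := fun _ => E) (I k) (K k) := by simp [hcon]
      simp only [mem_iInter, not_forall] at this
      obtain ⟨k, hk, hak⟩ := this
      refine mem_iUnion₂.2 ⟨k, hk, ?_⟩
      have h1 : a ∈ A k := hanti hk ha
      rw [hAS k] at h1
      rw [mem_cylinder] at h1 hak ⊢
      exact ⟨h1, hak⟩
    have hcyl : ∀ k, cylinder (α := fun _ => E) (I k) (S k \ K k) ∈
        measurableCylinders fun _ : ι => E := fun k =>
      cylinder_mem_measurableCylinders _ _ ((hS k).diff (hKm k))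
    have hfin : ∀ m, (⋃ k ≤ m, cylinder (α := fun _ => E) (I k) (S k \ K k)) ∈
        measurableCylinders fun _ : ι => E := fun m => by
      have : (⋃ k ≤ m, cylinder (α := fun _ => E) (I k) (S k \ K k)) =
          ⋃ k ∈ Finset.range (m + 1), cylinder (α := fun _ => E) (I k) (S k \ K k) := by
        simp only [Finset.mem_range_succ_iff]
      rw [this]
      exact isSetRing_measurableCylinders.biUnion_mem _ fun k _ => hcyl k
    have h1 : projectiveFamilyContent hP (A n) ≤ ∑' k, δ k := by
      calc projectiveFamilyContent hP (A n)
          ≤ projectiveFamilyContent hP (⋃ k ≤ n, cylinder (α := fun _ => E) (I k) (S k \ K k)) :=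
            projectiveFamilyContent_mono hP (hA n) (hfin n) hcover
        _ ≤ ∑ k ∈ Finset.range (n + 1),
              projectiveFamilyContent hP (cylinder (α := fun _ => E) (I k) (S k \ K k)) :=
            projectiveFamilyContent_iUnion_le hP hcyl n
        _ ≤ ∑ k ∈ Finset.range (n + 1), δ k := by
            refine Finset.sum_le_sum fun k _ => ?_
            rw [projectiveFamilyContent_cylinder hP ((hS k).diff (hKm k))]
            exact (hKδ k).le
        _ ≤ ∑' k, δ k := ENNReal.sum_le_tsum _
    exact absurd (hε.le.trans (iInf_le _ n)) (not_le.2 (h1.trans_lt hδsum))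
  obtain ⟨a, ha⟩ := nonempty_iInter_cylinder_of_isCompact I K hKc hne
  have : a ∈ ⋂ n, A n := mem_iInter.2 fun n => by
    rw [hAS n, mem_cylinder]
    exact hKS n ((mem_cylinder _ _ _).1 (mem_iInter.1 ha n))
  simp [hempty] at this

/-- **Kolmogorov extension theorem**: a projective family of finite measures on Polish spaces has
a projective limit. -/
theorem exists_isProjectiveLimit (hP : IsProjectiveMeasureFamily (α := fun _ : ι => E) P) :
    ∃ μ : Measure (ι → E), IsProjectiveLimit (α := fun _ : ι => E) μ P := by
  have hsub : (projectiveFamilyContent hP).IsSigmaSubadditive :=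
    isSigmaSubadditive_of_addContent_iUnion_eq_tsum isSetRing_measurableCylinders
      fun f hf hfU hdisj => addContent_iUnion_eq_sum_of_tendsto_zero isSetRing_measurableCylinders
        (projectiveFamilyContent hP) (fun _ _ => projectiveFamilyContent_ne_top hP)
        (fun _ hs hanti hempty => tendsto_projectiveFamilyContent_zero hP hs hanti hempty)
        hf hfU hdisj
  refine ⟨(projectiveFamilyContent hP).measure isSetSemiring_measurableCylinders
    generateFrom_measurableCylinders.ge hsub, fun J => ?_⟩
  ext s hs
  rw [Measure.map_apply (Finset.measurable_restrict J) hs, AddContent.measure_eq, ← cylinder,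
    projectiveFamilyContent_cylinder hP hs]
  · exact generateFrom_measurableCylinders.symm
  · exact cylinder_mem_measurableCylinders _ _ hs

end Kolmogorov

/-! ### Finite dimensional laws of a Lévy process with a given symbol -/

section FiniteDimensionalLaws

variable {m : ℕ} {Ψ : EuclideanSpace ℝ (Fin m) → ℂ}

/-- The step function `s ↦ ∑ i, 1_{s < τ i} p i`. -/
def stepFun {ι : Type*} (I : Finset ι) (τ : ι → ℝ≥0) (p : ι → EuclideanSpace ℝ (Fin m)) (s : ℝ) :
    EuclideanSpace ℝ (Fin m) :=
  ∑ i ∈ I, (Iio (τ i : ℝ)).indicator (fun _ => p i) s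

lemma stepFun_eq_zero {ι : Type*} {I : Finset ι} {τ : ι → ℝ≥0}
    {p : ι → EuclideanSpace ℝ (Fin m)} {s : ℝ} (h : ∀ i ∈ I, (τ i : ℝ) ≤ s) :
    stepFun I τ p s = 0 :=
  Finset.sum_eq_zero fun i hi => indicator_of_notMem (by simpa using h i hi) _

lemma measurable_cexp_sum_inner {α κ : Type*} [MeasurableSpace α] (J : Finset κ)
    {f : κ → α → EuclideanSpace ℝ (Fin m)} (hf : ∀ j, Measurable (f j))
    (p : κ → EuclideanSpace ℝ (Fin m)) :
    Measurable fun x => Complex.exp ((∑ j ∈ J, inner ℝ (f j x) (p j) : ℝ) * Complex.I) :=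
  ((Complex.measurable_ofReal.comp (Finset.measurable_fun_sum _ fun j _ =>
    (hf j).inner_const)).mul_const _).cexp

lemma measurable_stepFun {ι : Type*} (I : Finset ι) (τ : ι → ℝ≥0)
    (p : ι → EuclideanSpace ℝ (Fin m)) : Measurable (stepFun I τ p) :=
  Finset.measurable_fun_sum _ fun _ _ => measurable_const.indicator measurableSet_Iio

lemma norm_stepFun_le {ι : Type*} (I : Finset ι) (τ : ι → ℝ≥0)
    (p : ι → EuclideanSpace ℝ (Fin m)) (s : ℝ) : ‖stepFun I τ p s‖ ≤ ∑ i ∈ I, ‖p i‖ :=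
  (norm_sum_le _ _).trans (Finset.sum_le_sum fun _ _ => norm_indicator_le_norm_self _ _)

/-- The step function is bounded and vanishes beyond the largest time, where `Ψ 0 = 0` makes the
integrand vanish as well. -/
lemma integrableOn_symbol_stepFun (hΨ : Continuous Ψ) (hΨ0 : Ψ 0 = 0) {ι : Type*} (I : Finset ι)
    (τ : ι → ℝ≥0) (p : ι → EuclideanSpace ℝ (Fin m)) :
    IntegrableOn (fun s => Ψ (stepFun I τ p s)) (Ici 0) := by
  obtain ⟨C, hC⟩ := (isCompact_closedBall (0 : EuclideanSpace ℝ (Fin m))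
    (∑ i ∈ I, ‖p i‖)).exists_bound_of_continuousOn hΨ.continuousOn
  set T : ℝ≥0 := I.sup τ
  have hmeas : Measurable fun s => Ψ (stepFun I τ p s) :=
    hΨ.measurable.comp (measurable_stepFun I τ p)
  have h1 : IntegrableOn (fun s => Ψ (stepFun I τ p s)) (Icc 0 (T : ℝ)) := by
    refine Measure.integrableOn_of_bounded (M := C) (by simp) hmeas.aestronglyMeasurable
      (ae_of_all _ fun s => hC _ ?_)
    simpa using norm_stepFun_le I τ p s
  refine h1.of_forall_sdiff_eq_zero measurableSet_Ici fun s hs => ?_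
  have hs' : (T : ℝ) < s := by
    simp only [Set.mem_sdiff, mem_Ici, mem_Icc, not_and, not_le] at hs
    exact hs.2 hs.1
  rw [stepFun_eq_zero, hΨ0]
  exact fun i hi => (NNReal.coe_le_coe.2 (Finset.le_sup hi)).trans hs'.le

variable (hΨ : Continuous Ψ) (hΨ0 : Ψ 0 = 0)
  (hμ : ∀ u : ℝ≥0, ∃ μ : Measure (EuclideanSpace ℝ (Fin m)), IsProbabilityMeasure μ ∧
    ∀ p, charFun μ p = Complex.exp (-((u : ℝ) : ℂ) * Ψ p))

include hΨ hΨ0 in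
/-- Adding a time `a` after `t ∈ K`, where `t` is the largest element of `K`. -/
lemma integral_symbol_stepFun_insert {K : Finset ℝ≥0} {a t : ℝ≥0} (ht : t ∈ K)
    (hK : ∀ j ∈ K, j ≤ t) (hta : t < a) (p : ℝ≥0 → EuclideanSpace ℝ (Fin m)) :
    ∫ s in Ici (0 : ℝ), Ψ (stepFun (insert a K) id p s) =
      (∫ s in Ici (0 : ℝ), Ψ (stepFun K id (Function.update p t (p t + p a)) s)) +
        ((a - t : ℝ≥0) : ℝ) * Ψ (p a) := by
  have haK : a ∉ K := fun h => absurd (hK a h) (not_le.2 hta)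
  -- Before `t`, moving the weight `p a` onto the time `t` changes nothing; on `[t, a)` only `p a`
  -- is left; after `a` everything vanishes.
  have hpt : ∀ s, Ψ (stepFun (insert a K) id p s) =
      Ψ (stepFun K id (Function.update p t (p t + p a)) s) +
        (Ico (t : ℝ) a).indicator (fun _ => Ψ (p a)) s := by
    intro s
    have hins : stepFun (insert a K) id p s =
        (Iio (a : ℝ)).indicator (fun _ => p a) s + stepFun K id p s := by
      simp [stepFun, Finset.sum_insert haK]
    rcases lt_or_ge s t with hst | hst
    · have h1 : stepFun K id (Function.update p t (p t + p a)) s = stepFun K id p s + p a := by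
        unfold stepFun
        rw [← Finset.add_sum_erase _ _ ht, ← Finset.add_sum_erase (f := fun i =>
          (Iio ((id i : ℝ≥0) : ℝ)).indicator (fun _ => p i) s) _ ht]
        have h2 : ∀ x ∈ K.erase t,
            (Iio ((id x : ℝ≥0) : ℝ)).indicator
              (fun _ => Function.update p t (p t + p a) x) s =
            (Iio ((id x : ℝ≥0) : ℝ)).indicator (fun _ => p x) s := fun x hx => by
          rw [Function.update_of_ne (Finset.ne_of_mem_erase hx)]
        rw [Finset.sum_congr rfl h2]
        simp only [id, Function.update_self]
        rw [indicator_of_mem (show s ∈ Iio (t : ℝ) from hst),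
          indicator_of_mem (show s ∈ Iio (t : ℝ) from hst)]
        abel
      have h3 : s < a := hst.trans (by exact_mod_cast hta)
      rw [hins, h1, indicator_of_mem (show s ∈ Iio (a : ℝ) from h3),
        indicator_of_notMem (by simp [hst]), add_zero, add_comm]
    · have h1 : ∀ q, stepFun (m := m) K id q s = 0 := fun q =>
        stepFun_eq_zero fun j hj => (NNReal.coe_le_coe.2 (hK j hj)).trans hst
      rw [hins, h1, h1, hΨ0, add_zero, zero_add]
      by_cases hsa : s < a
      · rw [indicator_of_mem (show s ∈ Iio (a : ℝ) from hsa), indicator_of_mem (show s ∈ Ico (t : ℝ) a from ⟨hst, hsa⟩)]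
      · rw [indicator_of_notMem (by simpa using hsa), indicator_of_notMem (by simp [hsa]), hΨ0]
  simp_rw [hpt]
  rw [integral_add (integrableOn_symbol_stepFun hΨ hΨ0 _ _ _), setIntegral_indicator
    measurableSet_Ico, setIntegral_const]
  · have : Ici 0 ∩ Ico (t : ℝ) a = Ico (t : ℝ) a :=
      inter_eq_self_of_subset_right fun s hs => t.2.trans hs.1
    rw [this, Measure.real,
      Real.volume_Ico, ENNReal.toReal_ofReal (by simpa using hta.le), NNReal.coe_sub hta.le]
    simp
  · exact ((integrable_indicator_iff measurableSet_Ico).2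
      (integrableOn_const (by simp))).integrableOn

include hΨ hΨ0 hμ in
-- Times are added in increasing order: the value at a new last time is the value at the previous
-- one plus an independent increment with the prescribed law. The measure lives on the whole path
-- space, but only the coordinates in `insert 0 J` are controlled.
lemma exists_measure_fdd (J : Finset ℝ≥0) :
    ∃ P : Measure (ℝ≥0 → EuclideanSpace ℝ (Fin m)), IsProbabilityMeasure P ∧ ∀ p,
      ∫ x, Complex.exp ((∑ j ∈ insert 0 J, inner ℝ (x j) (p j) : ℝ) * Complex.I) ∂P =
        Complex.exp (-∫ s in Ici (0 : ℝ), Ψ (stepFun (insert 0 J) id p s)) := by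
  classical
  induction J using Finset.induction_on_max with
  | empty =>
    refine ⟨Measure.dirac 0, inferInstance, fun p => ?_⟩
    rw [integral_dirac' _ _ (measurable_cexp_sum_inner _ measurable_pi_apply p).stronglyMeasurable]
    have : ∀ s ∈ Ici (0 : ℝ), Ψ (stepFun (insert 0 ∅) id p s) = 0 := fun s hs => by
      rw [stepFun_eq_zero, hΨ0]
      simpa using hs
    rw [setIntegral_congr_fun measurableSet_Ici this]
    simp
  | insert a S hS ih =>
    obtain ⟨P, hP, hPp⟩ := ih
    rcases eq_or_ne a 0 with rfl | ha
    · exact ⟨P, hP, by simpa using hPp⟩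
    set K := insert 0 S with hKdef
    obtain ⟨t, htK, hKt⟩ := K.exists_max_image id ⟨0, Finset.mem_insert_self _ _⟩
    have hKa : ∀ j ∈ K, j < a := by
      intro j hj
      rcases Finset.mem_insert.1 hj with rfl | hj
      · exact pos_iff_ne_zero.2 ha
      · exact hS j hj
    have hta := hKa t htK
    have haK : a ∉ K := fun h => lt_irrefl _ (hKa a h)
    obtain ⟨μ, hμP, hμc⟩ := hμ (a - t)
    have hmeas : Measurable fun z : (ℝ≥0 → EuclideanSpace ℝ (Fin m)) × EuclideanSpace ℝ (Fin m) =>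
        Function.update z.1 a (z.1 t + z.2) := by
      refine measurable_pi_iff.2 fun j => ?_
      by_cases hj : j = a
      · subst hj
        simp only [Function.update_self]
        fun_prop
      · simp only [Function.update_of_ne hj]
        fun_prop
    refine ⟨(P.prod μ).map fun z => Function.update z.1 a (z.1 t + z.2),
      Measure.isProbabilityMeasure_map hmeas.aemeasurable, fun p => ?_⟩
    rw [Finset.insert_comm, ← hKdef, integral_map hmeas.aemeasurable
      (measurable_cexp_sum_inner _ measurable_pi_apply p).aestronglyMeasurable, integral_symbol_stepFun_insert hΨ hΨ0 htK hKt hta, neg_add, Complex.exp_add,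
      ← hPp, ← neg_mul, ← hμc, charFun_apply, ← integral_prod_mul]
    refine integral_congr_ae (ae_of_all _ fun z => ?_)
    simp only
    rw [← Complex.exp_add, ← add_mul, ← Complex.ofReal_add, Finset.sum_insert haK,
      Function.update_self]
    have h1 : ∑ j ∈ K, inner ℝ (Function.update z.1 a (z.1 t + z.2) j) (p j) =
        ∑ j ∈ K, inner ℝ (z.1 j) (p j) := Finset.sum_congr rfl fun j hj => by
      rw [Function.update_of_ne (hKa j hj).ne]
    have h2 : ∑ j ∈ K, inner ℝ (z.1 j) (Function.update p t (p t + p a) j) =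
        inner ℝ (z.1 t) (p a) + ∑ j ∈ K, inner ℝ (z.1 j) (p j) := by
      rw [← Finset.add_sum_erase _ _ htK, ← Finset.add_sum_erase (f := fun j =>
        inner ℝ (z.1 j) (p j)) _ htK, Function.update_self, inner_add_right]
      have : ∀ x ∈ K.erase t, inner ℝ (z.1 x) (Function.update p t (p t + p a) x) =
          inner ℝ (z.1 x) (p x) := fun x hx => by
        rw [Function.update_of_ne (Finset.ne_of_mem_erase hx)]
      rw [Finset.sum_congr rfl this]
      ring
    rw [h1, h2, inner_add_left]
    congr 3
    ring

include hΨ hΨ0 hμ in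
/-- There is a process with independent and stationary increments with symbol `Ψ`, in terms of its
finite dimensional characteristic functions. -/
theorem exists_measure_path :
    ∃ P : Measure (ℝ≥0 → EuclideanSpace ℝ (Fin m)), IsProbabilityMeasure P ∧
      ∀ {n : ℕ} (τ : Fin n → ℝ≥0) (p : Fin n → EuclideanSpace ℝ (Fin m)),
      ∫ x, Complex.exp ((∑ i, inner ℝ (x (τ i)) (p i) : ℝ) * Complex.I) ∂P =
        Complex.exp (-∫ s in Ici (0 : ℝ), Ψ (stepFun Finset.univ τ p s)) := by
  classical
  choose P hP hPp using exists_measure_fdd hΨ hΨ0 hμ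
  -- Weights extended by zero outside `J` show that the law of the coordinates in `J` does not
  -- depend on the larger set `K` used to construct it. This is the projectivity needed for the
  -- extension theorem.
  have key : ∀ (J K : Finset ℝ≥0), J ⊆ insert 0 K →
      ∀ p : ℝ≥0 → EuclideanSpace ℝ (Fin m),
      ∫ x, Complex.exp ((∑ j ∈ J, inner ℝ (x j) (p j) : ℝ) * Complex.I) ∂(P K) =
        Complex.exp (-∫ s in Ici (0 : ℝ), Ψ (stepFun J id p s)) := by
    intro J K hJK p
    have h := hPp K ((J : Set ℝ≥0).indicator p)
    have h1 : ∀ x : ℝ≥0 → EuclideanSpace ℝ (Fin m),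
        ∑ j ∈ insert 0 K, inner ℝ (x j) ((J : Set ℝ≥0).indicator p j) =
          ∑ j ∈ J, inner ℝ (x j) (p j) := fun x => by
      rw [← Finset.sum_subset hJK]
      · exact Finset.sum_congr rfl fun j hj => by rw [indicator_of_mem (by exact_mod_cast hj)]
      · intro j _ hj
        rw [indicator_of_notMem (by exact_mod_cast hj), inner_zero_right]
    have h2 : ∀ s, stepFun (insert 0 K) id ((J : Set ℝ≥0).indicator p) s = stepFun J id p s :=
        fun s => by
      unfold stepFun
      rw [← Finset.sum_subset hJK]
      · exact Finset.sum_congr rfl fun j hj => by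
          rw [indicator_of_mem (show j ∈ (J : Set ℝ≥0) by exact_mod_cast hj)]
      · intro j _ hj
        rw [indicator_of_notMem (show j ∉ (J : Set ℝ≥0) by exact_mod_cast hj)]
        simp
    simpa only [h1, h2] using h
  -- The Riesz representatives of the components of `L` turn a functional on the product into a
  -- family of weights.
  have hdual : ∀ (J K : Finset ℝ≥0), J ⊆ insert 0 K →
      ∀ L : StrongDual ℝ (J → EuclideanSpace ℝ (Fin m)),
      charFunDual ((P K).map J.restrict) L =
        Complex.exp (-∫ s in Ici (0 : ℝ), Ψ (stepFun J id (fun j => if h : j ∈ J then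
          (InnerProductSpace.toDual ℝ _).symm
            (L.comp (ContinuousLinearMap.single ℝ (fun _ : J => EuclideanSpace ℝ (Fin m)) ⟨j, h⟩))
          else 0) s)) := by
    intro J K hJK L
    rw [← key J K hJK, charFunDual_apply, integral_map (by fun_prop) (by fun_prop)]
    refine integral_congr_ae (ae_of_all _ fun x => ?_)
    simp only
    congr 3
    rw [← L.sum_comp_single, ← Finset.sum_coe_sort J]
    refine Finset.sum_congr rfl fun j _ => ?_
    rw [dif_pos j.2, real_inner_comm, InnerProductSpace.toDual_symm_apply]
    rfl
  have hproj : IsProjectiveMeasureFamily (α := fun _ : ℝ≥0 => EuclideanSpace ℝ (Fin m))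
      fun J : Finset ℝ≥0 => (P J).map J.restrict := by
    intro I J hJI
    have : IsProbabilityMeasure ((P J).map J.restrict) :=
      Measure.isProbabilityMeasure_map (by fun_prop)
    have h2 : ((P I).map I.restrict).map (Finset.restrict₂ (π := fun _ => EuclideanSpace ℝ (Fin m))
        hJI) = (P I).map J.restrict := by
      rw [Measure.map_map (Finset.measurable_restrict₂ hJI) (Finset.measurable_restrict I)]
      rfl
    rw [h2]
    have : IsProbabilityMeasure ((P I).map J.restrict) :=
      Measure.isProbabilityMeasure_map (by fun_prop)
    refine Measure.ext_of_charFunDual (funext fun L => ?_)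
    rw [hdual J J (Finset.subset_insert _ _), hdual J I (hJI.trans (Finset.subset_insert _ _))]
  have hfin : ∀ J : Finset ℝ≥0, IsProbabilityMeasure ((P J).map J.restrict) := fun J =>
    Measure.isProbabilityMeasure_map (by fun_prop)
  obtain ⟨Q, hQ⟩ := exists_isProjectiveLimit hproj
  have hQP : IsProbabilityMeasure Q := hQ.isProbabilityMeasure
  refine ⟨Q, hQP, fun {n} τ p => ?_⟩
  set J : Finset ℝ≥0 := Finset.univ.image τ
  -- The times `τ i` may repeat; the weights attached to the same time are added.
  set q : ℝ≥0 → EuclideanSpace ℝ (Fin m) := fun j => ∑ i with τ i = j, p i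
  have hmem : ∀ i ∈ (Finset.univ : Finset (Fin n)), τ i ∈ J := fun i hi =>
    Finset.mem_image_of_mem _ hi
  have h1 : ∀ x : ℝ≥0 → EuclideanSpace ℝ (Fin m), ∑ i, inner ℝ (x (τ i)) (p i) =
      ∑ j ∈ J, inner ℝ (x j) (q j) := fun x => by
    rw [← Finset.sum_fiberwise_of_maps_to hmem]
    refine Finset.sum_congr rfl fun j _ => ?_
    rw [inner_sum]
    exact Finset.sum_congr rfl fun i hi => by rw [(Finset.mem_filter.1 hi).2]
  have h2 : ∀ s, stepFun Finset.univ τ p s = stepFun J id q s := fun s => by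
    unfold stepFun
    rw [← Finset.sum_fiberwise_of_maps_to hmem]
    refine Finset.sum_congr rfl fun j _ => ?_
    by_cases hs : s < j
    · rw [indicator_of_mem (show s ∈ Iio ((id j : ℝ≥0) : ℝ) from hs)]
      exact Finset.sum_congr rfl fun i hi => by
        rw [(Finset.mem_filter.1 hi).2, indicator_of_mem (show s ∈ Iio (j : ℝ) from hs)]
    · rw [indicator_of_notMem (show s ∉ Iio ((id j : ℝ≥0) : ℝ) from hs)]
      exact Finset.sum_eq_zero fun i hi => by
        rw [(Finset.mem_filter.1 hi).2, indicator_of_notMem (show s ∉ Iio (j : ℝ) from hs)]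
  simp only [h1, h2]
  rw [← key J J (Finset.subset_insert _ _) q]
  have h3 : ∀ ρ : Measure (ℝ≥0 → EuclideanSpace ℝ (Fin m)),
      ∫ x, Complex.exp ((∑ j ∈ J, inner ℝ (x j) (q j) : ℝ) * Complex.I) ∂ρ =
      ∫ y : J → EuclideanSpace ℝ (Fin m),
        Complex.exp ((∑ j : J, inner ℝ (y j) (q j) : ℝ) * Complex.I) ∂(ρ.map J.restrict) :=
      fun ρ => by
    rw [integral_map (by fun_prop) (measurable_cexp_sum_inner (κ := J) _ measurable_pi_apply
      fun j : J => q j).aestronglyMeasurable]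
    refine integral_congr_ae (ae_of_all _ fun x => ?_)
    simp only [Finset.restrict]
    rw [Finset.sum_coe_sort J fun j => inner ℝ (x j) (q j)]
  rw [h3, h3, hQ J]

end FiniteDimensionalLaws

/-! ### Existence of a Lévy process with a given symbol -/

section LevyExistence

variable {m : ℕ} {Ψ : EuclideanSpace ℝ (Fin m) → ℂ}

/-- Random vectors whose characteristic functions tend to `1` tend to `0` in probability. -/
lemma tendsto_measure_norm_ge_of_tendsto_charFun {Ω : Type*} [MeasurableSpace Ω] {P : Measure Ω}
    [IsProbabilityMeasure P] {Y : ℕ → Ω → EuclideanSpace ℝ (Fin m)} (hY : ∀ n, Measurable (Y n))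
    (h : ∀ p, Tendsto (fun n => charFun (P.map (Y n)) p) atTop (𝓝 1)) {ε : ℝ} (hε : 0 < ε) :
    Tendsto (fun n => P {ω | ε ≤ ‖Y n ω‖}) atTop (𝓝 0) := by
  have hp : ∀ n, IsProbabilityMeasure (P.map (Y n)) := fun n =>
    Measure.isProbabilityMeasure_map (hY n).aemeasurable
  let μ : ℕ → ProbabilityMeasure (EuclideanSpace ℝ (Fin m)) := fun n => ⟨P.map (Y n), hp n⟩
  let δ : ProbabilityMeasure (EuclideanSpace ℝ (Fin m)) := ⟨Measure.dirac 0, inferInstance⟩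
  have hlim : Tendsto μ atTop (𝓝 δ) :=
    ProbabilityMeasure.tendsto_of_tendsto_charFun fun p => by
      simpa [μ, δ, charFun_dirac] using h p
  have hcl : IsClosed {y : EuclideanSpace ℝ (Fin m) | ε ≤ ‖y‖} :=
    isClosed_le continuous_const continuous_norm
  -- Portmanteau for a closed set that the limit law, the Dirac mass at `0`, does not charge.
  have h1 := ProbabilityMeasure.limsup_measure_closed_le_of_tendsto hlim hcl
  have h2 : (δ : Measure (EuclideanSpace ℝ (Fin m))) {y | ε ≤ ‖y‖} = 0 := by
    simp only [δ, ProbabilityMeasure.coe_mk]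
    rw [Measure.dirac_apply' _ hcl.measurableSet]
    simp [hε]
  rw [h2] at h1
  have h3 : ∀ n, (μ n : Measure (EuclideanSpace ℝ (Fin m))) {y | ε ≤ ‖y‖} =
      P {ω | ε ≤ ‖Y n ω‖} := fun n => by
    simp only [μ, ProbabilityMeasure.coe_mk]
    rw [Measure.map_apply (hY n) hcl.measurableSet]
    rfl
  simp only [h3] at h1
  exact tendsto_of_le_liminf_of_limsup_le bot_le h1

/-- Weights `p i` at `t (i+1)` and `-p i` at `t i` encode the increments in the formula of
`exists_measure_path`. -/
lemma stepFun_increment {n : ℕ} {t : Fin (n + 1) → ℝ≥0} (ht : Monotone t)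
    (p : Fin n → EuclideanSpace ℝ (Fin m)) (s : ℝ) :
    stepFun Finset.univ (Fin.append (fun i : Fin n => t i.succ) fun i : Fin n => t i.castSucc)
        (Fin.append p fun i => -p i) s =
      ∑ i, (Ico (t i.castSucc : ℝ) (t i.succ)).indicator (fun _ => p i) s := by
  unfold stepFun
  rw [Fin.sum_univ_add, ← Finset.sum_add_distrib]
  refine Finset.sum_congr rfl fun i _ => ?_
  simp only [Fin.append_left, Fin.append_right]
  have hle : (t i.castSucc : ℝ) ≤ t i.succ := NNReal.coe_le_coe.2 (ht (Fin.castSucc_le_succ i))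
  by_cases h1 : s < t i.castSucc
  · have h2 : s < t i.succ := h1.trans_le hle
    simp [indicator, h1, h2]
  · by_cases h2 : s < t i.succ
    · simp [indicator, not_lt.1 h1, h2]
    · simp [indicator, h1, h2]

/-- The intervals are disjoint, so at most one term is nonzero and no additivity of `Ψ` is required.
This is why the characteristic functions of increments factorise. -/
lemma symbol_sum_indicator_Ico (hΨ0 : Ψ 0 = 0) {n : ℕ} {t : Fin (n + 1) → ℝ≥0} (ht : Monotone t)
    (p : Fin n → EuclideanSpace ℝ (Fin m)) (s : ℝ) :
    Ψ (∑ i, (Ico (t i.castSucc : ℝ) (t i.succ)).indicator (fun _ => p i) s) =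
      ∑ i, (Ico (t i.castSucc : ℝ) (t i.succ)).indicator (fun _ => Ψ (p i)) s := by
  by_cases h : ∃ i : Fin n, s ∈ Ico (t i.castSucc : ℝ) (t i.succ)
  · obtain ⟨i, hi⟩ := h
    have hne : ∀ j, j ≠ i → s ∉ Ico (t j.castSucc : ℝ) (t j.succ) := by
      intro j hj hjs
      rcases lt_or_gt_of_ne hj with hlt | hlt
      · have : (t j.succ : ℝ) ≤ t i.castSucc := NNReal.coe_le_coe.2 (ht (by
          rw [Fin.le_def]; simpa using hlt))
        exact absurd (hjs.2.trans_le this) (not_lt.2 hi.1)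
      · have : (t i.succ : ℝ) ≤ t j.castSucc := NNReal.coe_le_coe.2 (ht (by
          rw [Fin.le_def]; simpa using hlt))
        exact absurd (hi.2.trans_le this) (not_lt.2 hjs.1)
    rw [Finset.sum_eq_single i (fun j _ hj => indicator_of_notMem (hne j hj) _) (by simp),
      Finset.sum_eq_single i (fun j _ hj => indicator_of_notMem (hne j hj) _) (by simp),
      indicator_of_mem hi, indicator_of_mem hi]
  · push Not at h
    rw [Finset.sum_eq_zero fun i _ => indicator_of_notMem (h i) _,
      Finset.sum_eq_zero fun i _ => indicator_of_notMem (h i) _, hΨ0]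

/-- A Lévy process with symbol `Ψ` exists as soon as, for every `u`, the function `exp (-u Ψ)` is
the characteristic function of a probability measure. -/
theorem exists_isLevyProcess (hΨ : Continuous Ψ) (hΨ0 : Ψ 0 = 0)
    (hμ : ∀ u : ℝ≥0, ∃ μ : Measure (EuclideanSpace ℝ (Fin m)), IsProbabilityMeasure μ ∧
      ∀ p, charFun μ p = Complex.exp (-((u : ℝ) : ℂ) * Ψ p)) :
    ∃ P : Measure (ℝ≥0 → EuclideanSpace ℝ (Fin m)), IsProbabilityMeasure P ∧
      IsLevyProcess P (fun u x => x u) ∧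
      ∀ (u : ℝ≥0) p, charFun (P.map fun x => x u) p = Complex.exp (-((u : ℝ) : ℂ) * Ψ p) := by
  obtain ⟨P, hP, key⟩ := exists_measure_path hΨ hΨ0 hμ
  refine ⟨P, hP, ?_⟩
  have hincr : ∀ {n : ℕ} {t : Fin (n + 1) → ℝ≥0} (_ : Monotone t)
      (p : Fin n → EuclideanSpace ℝ (Fin m)),
      ∫ x, Complex.exp ((∑ i : Fin n, inner ℝ (x (t i.succ) - x (t i.castSucc)) (p i) : ℝ) *
        Complex.I) ∂P =
        ∏ i : Fin n, Complex.exp (-((t i.succ - t i.castSucc : ℝ) : ℂ) * Ψ (p i)) := by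
    intro n t ht p
    have h := key (Fin.append (fun i : Fin n => t i.succ) fun i : Fin n => t i.castSucc)
      (Fin.append p fun i => -p i)
    have h1 : ∀ x : ℝ≥0 → EuclideanSpace ℝ (Fin m),
        ∑ i, inner ℝ (x (Fin.append (fun i : Fin n => t i.succ)
          (fun i : Fin n => t i.castSucc) i)) (Fin.append p (fun i => -p i) i) =
        ∑ i : Fin n, inner ℝ (x (t i.succ) - x (t i.castSucc)) (p i) := fun x => by
      rw [Fin.sum_univ_add, ← Finset.sum_add_distrib]
      refine Finset.sum_congr rfl fun i _ => ?_
      simp only [Fin.append_left, Fin.append_right, inner_sub_left, inner_neg_right]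
      ring
    simp only [h1, stepFun_increment ht, symbol_sum_indicator_Ico hΨ0 ht] at h
    rw [h, integral_finsetSum, ← Finset.sum_neg_distrib, Complex.exp_sum]
    · refine Finset.prod_congr rfl fun i _ => ?_
      have hle : (t i.castSucc : ℝ) ≤ t i.succ :=
        NNReal.coe_le_coe.2 (ht (Fin.castSucc_le_succ i))
      have hI : Ici 0 ∩ Ico (t i.castSucc : ℝ) (t i.succ) = Ico (t i.castSucc : ℝ) (t i.succ) :=
        inter_eq_self_of_subset_right fun s hs => (t i.castSucc).2.trans hs.1
      rw [setIntegral_indicator measurableSet_Ico, hI, setIntegral_const, Measure.real,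
        Real.volume_Ico, ENNReal.toReal_ofReal (by simpa using hle)]
      simp only [Complex.real_smul, neg_mul]
    · exact fun i _ => ((integrable_indicator_iff measurableSet_Ico).2
        (integrableOn_const (by simp))).integrableOn
  have hincr1 : ∀ {u v : ℝ≥0} (_ : u ≤ v) (p : EuclideanSpace ℝ (Fin m)),
      charFun (P.map fun x => x v - x u) p = Complex.exp (-((v - u : ℝ) : ℂ) * Ψ p) := by
    intro u v huv p
    have ht : Monotone (![u, v] : Fin 2 → ℝ≥0) := by
      rw [Fin.monotone_iff_le_succ]
      intro i
      fin_cases i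
      simpa using huv
    have h := hincr ht fun _ => p
    rw [charFun_apply, integral_map (by fun_prop) (by fun_prop)]
    simpa using h
  have hzero : ∀ᵐ x ∂P, x 0 = 0 := by
    have hp : IsProbabilityMeasure (P.map fun x : ℝ≥0 → EuclideanSpace ℝ (Fin m) => x 0) :=
      Measure.isProbabilityMeasure_map (measurable_pi_apply _).aemeasurable
    have h : P.map (fun x : ℝ≥0 → EuclideanSpace ℝ (Fin m) => x 0) = Measure.dirac 0 := by
      refine Measure.ext_of_charFun (funext fun p => ?_)
      have h := key (n := 1) (fun _ => 0) fun _ => p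
      have h0 : ∀ s ∈ Ici (0 : ℝ), Ψ (stepFun (Finset.univ : Finset (Fin 1)) (fun _ => 0)
          (fun _ => p) s) = 0 := fun s hs => by
        rw [stepFun_eq_zero, hΨ0]
        simpa using hs
      rw [setIntegral_congr_fun measurableSet_Ici h0] at h
      rw [charFun_dirac, charFun_apply, integral_map (measurable_pi_apply _).aemeasurable
        (by fun_prop)]
      simpa using h
    have h2 : ∀ᵐ y ∂(P.map fun x : ℝ≥0 → EuclideanSpace ℝ (Fin m) => x 0), y = 0 := by
      rw [h]
      exact (ae_dirac_iff (measurableSet_singleton _)).2 rfl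
    exact ae_of_ae_map (measurable_pi_apply _).aemeasurable h2
  have hchar : ∀ (u : ℝ≥0) p,
      charFun (P.map fun x => x u) p = Complex.exp (-((u : ℝ) : ℂ) * Ψ p) := by
    intro u p
    have h := hincr1 (zero_le : 0 ≤ u) p
    have h2 : P.map (fun x => x u - x 0) = P.map fun x => x u :=
      Measure.map_congr (by filter_upwards [hzero] with x hx; simp [hx])
    rw [h2] at h
    simpa using h
  refine ⟨⟨fun u => measurable_pi_apply u, hzero, ?_, ?_, ?_⟩, hchar⟩
  · intro n t ht
    -- Independence holds because the joint characteristic function of the increments is the product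
    -- of the marginal ones.
    refine (iIndepFun_iff_charFun_pi fun i => by fun_prop).2 fun p => ?_
    have h := hincr ht fun i => p i
    rw [charFun_apply, integral_map (by fun_prop) (by fun_prop)]
    refine Eq.trans ?_ (h.trans ?_)
    · rfl
    refine Finset.prod_congr rfl fun i _ => ?_
    rw [hincr1 (ht (Fin.castSucc_le_succ i))]
  · intro u v
    refine ⟨by fun_prop, (measurable_pi_apply _).aemeasurable, ?_⟩
    have hp1 : IsProbabilityMeasure (P.map fun x : ℝ≥0 → EuclideanSpace ℝ (Fin m) =>
        x (u + v) - x u) := Measure.isProbabilityMeasure_map (by fun_prop)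
    have hp2 : IsProbabilityMeasure (P.map fun x : ℝ≥0 → EuclideanSpace ℝ (Fin m) => x v) :=
      Measure.isProbabilityMeasure_map (measurable_pi_apply _).aemeasurable
    refine Measure.ext_of_charFun (funext fun p => ?_)
    rw [hincr1 le_self_add, hchar]
    simp
  · intro u
    rw [tendstoInMeasure_iff_norm]
    intro ε hε
    -- Lévy's continuity theorem is applied along sequences; the times may approach `u` from both
    -- sides, hence the two formulas in `hb`.
    refine tendsto_of_seq_tendsto fun v hv => ?_
    refine tendsto_measure_norm_ge_of_tendsto_charFun
      (Y := fun n (x : ℝ≥0 → EuclideanSpace ℝ (Fin m)) => x (v n) - x u) (fun n => by fun_prop)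
      (fun p => ?_) hε
    have hb : ∀ n, charFun (P.map fun x : ℝ≥0 → EuclideanSpace ℝ (Fin m) => x (v n) - x u) p =
        if u ≤ v n then Complex.exp (-((v n - u : ℝ) : ℂ) * Ψ p)
        else Complex.exp (-((u - v n : ℝ) : ℂ) * Ψ (-p)) := by
      intro n
      split_ifs with h
      · exact hincr1 h p
      · rw [← hincr1 (le_of_not_ge h), charFun_apply, charFun_apply,
          integral_map (by fun_prop) (by fun_prop), integral_map (by fun_prop) (by fun_prop)]
        refine integral_congr_ae (ae_of_all _ fun x => ?_)
        simp only
        rw [inner_neg_right, ← inner_neg_left, neg_sub]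
    have hv' : Tendsto (fun n => (v n : ℝ)) atTop (𝓝 (u : ℝ)) :=
      (NNReal.continuous_coe.tendsto u).comp hv
    have l1 : Tendsto (fun n => Complex.exp (-((v n - u : ℝ) : ℂ) * Ψ p)) atTop (𝓝 1) := by
      have hc : Continuous fun r : ℝ => Complex.exp (-((r - u : ℝ) : ℂ) * Ψ p) := by fun_prop
      simpa [Function.comp_def] using (hc.tendsto (u : ℝ)).comp hv'
    have l2 : Tendsto (fun n => Complex.exp (-((u - v n : ℝ) : ℂ) * Ψ (-p))) atTop (𝓝 1) := by
      have hc : Continuous fun r : ℝ => Complex.exp (-((u - r : ℝ) : ℂ) * Ψ (-p)) := by fun_prop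
      simpa [Function.comp_def] using (hc.tendsto (u : ℝ)).comp hv'
    simp only [hb]
    exact Tendsto.if' l1 l2

end LevyExistence

/-! ### The Lévy symbol -/

section Symbol

variable {m : ℕ}

/-- The integrand of the Lévy symbol. -/
def levyKernel (p z : EuclideanSpace ℝ (Fin m)) : ℂ :=
  1 - Complex.exp (Complex.I * (inner ℝ p z : ℝ)) +
    Complex.I * ((Metric.ball (0 : EuclideanSpace ℝ (Fin m)) 1).indicator
      (fun z => inner ℝ p z) z : ℝ)

lemma levySymbol_eq (Q : Matrix (Fin m) (Fin m) ℝ) (b : EuclideanSpace ℝ (Fin m))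
    (ν : Measure (EuclideanSpace ℝ (Fin m))) (p : EuclideanSpace ℝ (Fin m)) :
    levySymbol Q b ν p = -Complex.I * (inner ℝ b p : ℝ) +
      (1 / 2 : ℂ) * (inner ℝ p (Matrix.toEuclideanLin Q p) : ℝ) + ∫ z, levyKernel p z ∂ν := rfl

lemma norm_one_sub_exp_add_le (x : ℝ) :
    ‖1 - Complex.exp (Complex.I * x) + Complex.I * x‖ ≤ 3 * x ^ 2 := by
  rcases le_or_gt |x| 1 with hx | hx
  · have h := Complex.norm_exp_sub_one_sub_id_le (x := Complex.I * x) (by simpa using hx)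
    rw [← norm_neg] at h
    have h2 : -(Complex.exp (Complex.I * x) - 1 - Complex.I * x) =
        1 - Complex.exp (Complex.I * x) + Complex.I * x := by ring
    rw [h2] at h
    refine h.trans ?_
    simp only [norm_mul, Complex.norm_I, one_mul, Complex.norm_real, Real.norm_eq_abs, sq_abs]
    nlinarith [sq_nonneg x]
  · have h1 : ‖Complex.exp (Complex.I * x)‖ = 1 := by
      rw [mul_comm]; exact Complex.norm_exp_ofReal_mul_I x
    calc ‖1 - Complex.exp (Complex.I * x) + Complex.I * x‖
        ≤ ‖(1 : ℂ)‖ + ‖Complex.exp (Complex.I * x)‖ + ‖Complex.I * x‖ :=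
          (norm_add_le _ _).trans (add_le_add (norm_sub_le _ _) le_rfl)
      _ = 2 + |x| := by simp [h1]; norm_num
      _ ≤ 3 * x ^ 2 := by
          rw [← sq_abs]
          nlinarith

/-- Inside the unit ball the compensator leaves a quadratic remainder; outside, the kernel is at
most `2`. Both are dominated by the weight that a Lévy measure integrates. -/
lemma norm_levyKernel_le (p z : EuclideanSpace ℝ (Fin m)) :
    ‖levyKernel p z‖ ≤ (2 + 3 * ‖p‖ ^ 2) * min 1 (‖z‖ ^ 2) := by
  unfold levyKernel
  by_cases hz : ‖z‖ < 1
  · rw [indicator_of_mem (by simpa using hz)]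
    have h1 : min 1 (‖z‖ ^ 2) = ‖z‖ ^ 2 := min_eq_right (by nlinarith [norm_nonneg z])
    have h2 : (inner ℝ p z : ℝ) ^ 2 ≤ ‖p‖ ^ 2 * ‖z‖ ^ 2 := by
      rw [← mul_pow, ← sq_abs]
      exact pow_le_pow_left₀ (abs_nonneg _) (abs_real_inner_le_norm p z) 2
    refine (norm_one_sub_exp_add_le _).trans ?_
    rw [h1]
    nlinarith [sq_nonneg ‖z‖]
  · rw [indicator_of_notMem (by simpa using hz)]
    have h1 : min 1 (‖z‖ ^ 2) = 1 := min_eq_left (by nlinarith [not_lt.1 hz])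
    have h2 : ‖Complex.exp (Complex.I * (inner ℝ p z : ℝ))‖ = 1 := by
      rw [mul_comm]; exact Complex.norm_exp_ofReal_mul_I _
    rw [h1]
    simp only [Complex.ofReal_zero, mul_zero, add_zero, mul_one]
    refine (norm_sub_le _ _).trans ?_
    rw [h2, norm_one]
    nlinarith [sq_nonneg ‖p‖]

lemma measurable_levyKernel (p : EuclideanSpace ℝ (Fin m)) : Measurable (levyKernel p) := by
  unfold levyKernel
  have h : Measurable fun z : EuclideanSpace ℝ (Fin m) =>
      (Metric.ball (0 : EuclideanSpace ℝ (Fin m)) 1).indicator (fun z => inner ℝ p z) z :=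
    Measurable.indicator (by fun_prop) measurableSet_ball
  fun_prop

lemma continuous_levyKernel_left (z : EuclideanSpace ℝ (Fin m)) :
    Continuous fun p => levyKernel p z := by
  unfold levyKernel
  by_cases hz : z ∈ Metric.ball (0 : EuclideanSpace ℝ (Fin m)) 1
  · simp only [indicator_of_mem hz]
    fun_prop
  · simp only [indicator_of_notMem hz]
    fun_prop

variable {ν : Measure (EuclideanSpace ℝ (Fin m))}

lemma IsLevyMeasure.integrable_min (hν : IsLevyMeasure ν) :
    Integrable (fun z : EuclideanSpace ℝ (Fin m) => min 1 (‖z‖ ^ 2)) ν := by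
  refine ⟨by fun_prop, ?_⟩
  rw [hasFiniteIntegral_iff_ofReal (ae_of_all _ fun z => by positivity)]
  exact hν.lintegral_lt_top

/-- By Markov's inequality the superlevel sets of `1 ∧ |z|²` have finite mass, and together with the
null set `{0}` they exhaust the space. This gives access to product measures and Fubini. -/
lemma IsLevyMeasure.sigmaFinite (hν : IsLevyMeasure ν) : SigmaFinite ν := by
  have h : ∀ n : ℕ, ν {z | 1 / ((n : ℝ) + 1) ≤ min 1 (‖z‖ ^ 2)} < ∞ := fun n =>
    hν.integrable_min.measure_ge_lt_top (by positivity)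
  refine ⟨⟨⟨fun n => {0} ∪ {z | 1 / ((n : ℝ) + 1) ≤ min 1 (‖z‖ ^ 2)}, fun _ => mem_univ _,
    fun n => ?_, ?_⟩⟩⟩
  · exact (measure_union_le _ _).trans_lt (by rw [hν.zero, zero_add]; exact h n)
  · refine eq_univ_of_forall fun z => mem_iUnion.2 ?_
    by_cases hz : z = 0
    · exact ⟨0, Or.inl hz⟩
    · obtain ⟨n, hn⟩ := exists_nat_one_div_lt (K := ℝ)
        (show 0 < min 1 (‖z‖ ^ 2) from lt_min one_pos (by positivity))
      exact ⟨n, Or.inr hn.le⟩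

lemma IsLevyMeasure.integrable_levyKernel (hν : IsLevyMeasure ν) (p : EuclideanSpace ℝ (Fin m)) :
    Integrable (levyKernel p) ν :=
  (hν.integrable_min.const_mul (2 + 3 * ‖p‖ ^ 2)).mono'
    (measurable_levyKernel p).aestronglyMeasurable (ae_of_all _ fun z => norm_levyKernel_le p z)

lemma IsLevyMeasure.continuous_levySymbol (hν : IsLevyMeasure ν) (Q : Matrix (Fin m) (Fin m) ℝ)
    (b : EuclideanSpace ℝ (Fin m)) : Continuous (levySymbol Q b ν) := by
  have h1 : Continuous fun p : EuclideanSpace ℝ (Fin m) => ∫ z, levyKernel p z ∂ν := by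
    refine continuous_iff_continuousAt.2 fun p₀ => ?_
    refine continuousAt_of_dominated
      (bound := fun z => (2 + 3 * (‖p₀‖ + 1) ^ 2) * min 1 (‖z‖ ^ 2))
      (Eventually.of_forall fun p => (measurable_levyKernel p).aestronglyMeasurable) ?_
      (hν.integrable_min.const_mul _)
      (ae_of_all _ fun z => (continuous_levyKernel_left z).continuousAt)
    have hev : ∀ᶠ p in 𝓝 p₀, ‖p‖ < ‖p₀‖ + 1 :=
      continuous_norm.continuousAt.eventually_lt_const (by simp)
    filter_upwards [hev] with p hp
    refine ae_of_all _ fun z => (norm_levyKernel_le p z).trans ?_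
    have : (0 : ℝ) ≤ min 1 (‖z‖ ^ 2) := by positivity
    gcongr
  have h2 : Continuous (Matrix.toEuclideanLin Q) := LinearMap.continuous_of_finiteDimensional _
  simp only [funext (levySymbol_eq Q b ν)]
  fun_prop

lemma levySymbol_zero (Q : Matrix (Fin m) (Fin m) ℝ) (b : EuclideanSpace ℝ (Fin m))
    (ν : Measure (EuclideanSpace ℝ (Fin m))) : levySymbol Q b ν 0 = 0 := by
  simp [levySymbol]

end Symbol

/-! ### Averages of Lévy symbols along a curve of linear maps -/

section Transfer

variable {N d : ℕ} {L : ℝ → EuclideanSpace ℝ (Fin d) →L[ℝ] EuclideanSpace ℝ (Fin N)}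
  {ν : Measure (EuclideanSpace ℝ (Fin d))}

/-- The image of `dr ⊗ ν` on `(0, 1] × ℝ^d` under `(r, z) ↦ L r z`. -/
def mixedMeasure (L : ℝ → EuclideanSpace ℝ (Fin d) →L[ℝ] EuclideanSpace ℝ (Fin N))
    (ν : Measure (EuclideanSpace ℝ (Fin d))) : Measure (EuclideanSpace ℝ (Fin N)) :=
  ((volume.restrict (Ioc (0 : ℝ) 1)).prod ν).map fun x => L x.1 x.2

lemma measurable_apply_prod (hL : Continuous L) :
    Measurable fun x : ℝ × EuclideanSpace ℝ (Fin d) => L x.1 x.2 :=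
  ((hL.comp continuous_fst).clm_apply continuous_snd).measurable

lemma exists_norm_le (hL : Continuous L) :
    ∃ C : ℝ, 1 ≤ C ∧ ∀ r ∈ Ioc (0 : ℝ) 1, ∀ z, ‖L r z‖ ≤ C * ‖z‖ := by
  obtain ⟨C, hC⟩ := (isCompact_Icc (a := (0 : ℝ)) (b := 1)).exists_bound_of_continuousOn
    hL.continuousOn
  exact ⟨max 1 C, le_max_left _ _, fun r hr z => ((L r).le_opNorm z).trans
    (mul_le_mul_of_nonneg_right ((hC r (Ioc_subset_Icc_self hr)).trans (le_max_right _ _))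
      (norm_nonneg _))⟩

lemma ae_mem_Ioc_prod [SFinite ν] :
    ∀ᵐ x ∂((volume.restrict (Ioc (0 : ℝ) 1)).prod ν), x.1 ∈ Ioc (0 : ℝ) 1 :=
  Measure.quasiMeasurePreserving_fst.ae (ae_restrict_mem measurableSet_Ioc)

lemma min_one_sq_le {C a b : ℝ} (hC : 1 ≤ C) (ha : 0 ≤ a) (hab : a ≤ C * b) :
    min 1 (a ^ 2) ≤ C ^ 2 * min 1 (b ^ 2) := by
  rw [mul_min_of_nonneg _ _ (sq_nonneg C), ← mul_pow]
  exact min_le_min (by nlinarith) (pow_le_pow_left₀ ha hab 2)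

/-- Injectivity of `L r` serves only to keep mass away from `0`; integrability follows from the
uniform bound on `‖L r‖`. -/
lemma IsLevyMeasure.mixedMeasure (hν : IsLevyMeasure ν) (hL : Continuous L)
    (hinj : ∀ r ∈ Icc (0 : ℝ) 1, Function.Injective (L r)) : IsLevyMeasure (mixedMeasure L ν) := by
  have := hν.sigmaFinite
  obtain ⟨C, hC, hLC⟩ := exists_norm_le hL
  have hm := measurable_apply_prod hL
  constructor
  · rw [_root_.mixedMeasure, Measure.map_apply hm (measurableSet_singleton _),
      Measure.measure_prod_null (hm (measurableSet_singleton _))]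
    filter_upwards [ae_restrict_mem measurableSet_Ioc] with r hr
    have : Prod.mk r ⁻¹' ((fun x : ℝ × EuclideanSpace ℝ (Fin d) => L x.1 x.2) ⁻¹' {0}) = {0} := by
      ext z
      simp only [mem_preimage, mem_singleton_iff]
      exact map_eq_zero_iff _ (hinj r (Ioc_subset_Icc_self hr))
    rw [this, hν.zero, Pi.zero_apply]
  · rw [_root_.mixedMeasure, lintegral_map (by fun_prop) hm]
    have hint : Integrable (fun x : ℝ × EuclideanSpace ℝ (Fin d) => C ^ 2 * min 1 (‖x.2‖ ^ 2))
        ((volume.restrict (Ioc (0 : ℝ) 1)).prod ν) :=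
      (hν.integrable_min.comp_snd _).const_mul _
    refine (lintegral_mono_ae ?_).trans_lt
      ((hasFiniteIntegral_iff_ofReal (ae_of_all _ fun x => by positivity)).1 hint.2)
    filter_upwards [ae_mem_Ioc_prod] with x hx
    exact ENNReal.ofReal_le_ofReal (min_one_sq_le hC (norm_nonneg _) (hLC _ hx _))

/-- The discrepancy between the truncations before and after applying `L r`. -/
def truncationDefect (L : ℝ → EuclideanSpace ℝ (Fin d) →L[ℝ] EuclideanSpace ℝ (Fin N))
    (x : ℝ × EuclideanSpace ℝ (Fin d)) : EuclideanSpace ℝ (Fin N) :=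
  (Metric.ball (0 : EuclideanSpace ℝ (Fin d)) 1).indicator (fun z => L x.1 z) x.2 -
    (Metric.ball (0 : EuclideanSpace ℝ (Fin N)) 1).indicator id (L x.1 x.2)

lemma levyKernel_adjoint (r : ℝ) (z : EuclideanSpace ℝ (Fin d)) (p : EuclideanSpace ℝ (Fin N)) :
    levyKernel ((L r).adjoint p) z =
      levyKernel p (L r z) + Complex.I * (inner ℝ p (truncationDefect L (r, z)) : ℝ) := by
  simp only [levyKernel, truncationDefect, ContinuousLinearMap.adjoint_inner_left, inner_sub_right]
  by_cases h1 : z ∈ Metric.ball (0 : EuclideanSpace ℝ (Fin d)) 1 <;>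
  by_cases h2 : L r z ∈ Metric.ball (0 : EuclideanSpace ℝ (Fin N)) 1 <;>
  simp [indicator, h1, h2]

/-- The defect is nonzero only when exactly one of `z`, `L r z` lies in its unit ball. If `‖z‖ < 1 ≤
‖L r z‖`, then `‖L r z‖ ≤ C‖z‖ ≤ (C‖z‖)²`; in the opposite case the defect has norm below `1`, while
`1 ∧ ‖z‖² = 1`. -/
lemma integrable_truncationDefect (hν : IsLevyMeasure ν) (hL : Continuous L) :
    Integrable (truncationDefect L) ((volume.restrict (Ioc (0 : ℝ) 1)).prod ν) := by
  have := hν.sigmaFinite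
  obtain ⟨C, hC, hLC⟩ := exists_norm_le hL
  have hm := measurable_apply_prod hL
  have hmeas : Measurable (truncationDefect L) := by
    have h1 : Measurable fun x : ℝ × EuclideanSpace ℝ (Fin d) =>
        (Metric.ball (0 : EuclideanSpace ℝ (Fin d)) 1).indicator (fun z => L x.1 z) x.2 :=
      Measurable.indicator (s := Prod.snd ⁻¹' Metric.ball (0 : EuclideanSpace ℝ (Fin d)) 1) hm
        (measurable_snd measurableSet_ball)
    exact h1.sub ((measurable_id.indicator measurableSet_ball).comp hm)
  refine ((hν.integrable_min.comp_snd _).const_mul (C ^ 2)).mono' hmeas.aestronglyMeasurable ?_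
  filter_upwards [ae_mem_Ioc_prod] with x hx
  have hb := hLC _ hx x.2
  unfold truncationDefect
  by_cases h1 : ‖x.2‖ < 1 <;> by_cases h2 : ‖L x.1 x.2‖ < 1
  · simp only [indicator, mem_ball_zero_iff, h1, h2, if_true, id, sub_self, norm_zero]
    positivity
  · simp only [indicator, mem_ball_zero_iff, h1, h2, if_true, if_false, sub_zero]
    rw [min_eq_right (by nlinarith [norm_nonneg x.2])]
    nlinarith [norm_nonneg x.2]
  · simp only [indicator, mem_ball_zero_iff, h1, h2, if_true, if_false, id, zero_sub, norm_neg]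
    rw [min_eq_left (by nlinarith [not_lt.1 h1])]
    nlinarith
  · simp only [indicator, mem_ball_zero_iff, h1, h2, if_false, sub_zero, norm_zero]
    positivity

/-- The matrix `∫₀¹ L r Q (L r)ᵀ dr`. -/
def mixedMatrix (L : ℝ → EuclideanSpace ℝ (Fin d) →L[ℝ] EuclideanSpace ℝ (Fin N))
    (Q : Matrix (Fin d) (Fin d) ℝ) : Matrix (Fin N) (Fin N) ℝ :=
  Matrix.of fun i j => ∫ r in (0 : ℝ)..1,
    inner ℝ ((L r).adjoint (EuclideanSpace.single i 1))
      (Matrix.toEuclideanLin Q ((L r).adjoint (EuclideanSpace.single j 1)))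

lemma continuous_adjoint_apply (hL : Continuous L) (p : EuclideanSpace ℝ (Fin N)) :
    Continuous fun r => (L r).adjoint p :=
  (ContinuousLinearMap.adjoint.continuous.comp hL).clm_apply continuous_const

lemma inner_mixedMatrix (hL : Continuous L) (Q : Matrix (Fin d) (Fin d) ℝ)
    (p : EuclideanSpace ℝ (Fin N)) :
    inner ℝ p (Matrix.toEuclideanLin (mixedMatrix L Q) p) =
      ∫ r in (0 : ℝ)..1, inner ℝ ((L r).adjoint p)
        (Matrix.toEuclideanLin Q ((L r).adjoint p)) := by
  have hQ : Continuous (Matrix.toEuclideanLin Q) := LinearMap.continuous_of_finiteDimensional _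
  have hp : p = ∑ i, p i • EuclideanSpace.single i (1 : ℝ) := by
    ext j
    simp [Finset.sum_apply, Pi.single_apply]
  have h1 : ∀ r, inner ℝ ((L r).adjoint p) (Matrix.toEuclideanLin Q ((L r).adjoint p)) =
      ∑ i, ∑ j, p i * (p j * inner ℝ ((L r).adjoint (EuclideanSpace.single i 1))
        (Matrix.toEuclideanLin Q ((L r).adjoint (EuclideanSpace.single j 1)))) := fun r => by
    conv_lhs => rw [hp]
    simp only [map_sum, map_smul, sum_inner, inner_sum, real_inner_smul_left,
      real_inner_smul_right]
    rw [Finset.sum_comm]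
    refine Finset.sum_congr rfl fun i _ => Finset.sum_congr rfl fun j _ => ?_
    ring
  have hc : ∀ i j, Continuous fun r => p i * (p j *
      inner ℝ ((L r).adjoint (EuclideanSpace.single i 1))
        (Matrix.toEuclideanLin Q ((L r).adjoint (EuclideanSpace.single j 1)))) := fun i j =>
    continuous_const.mul (continuous_const.mul ((continuous_adjoint_apply hL _).inner
      (hQ.comp (continuous_adjoint_apply hL _))))
  simp only [h1]
  rw [intervalIntegral.integral_finsetSum fun i _ =>
    (continuous_finsetSum _ fun j _ => hc i j).intervalIntegrable _ _]
  rw [PiLp.inner_apply]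
  refine Finset.sum_congr rfl fun i _ => ?_
  rw [intervalIntegral.integral_finsetSum fun j _ => (hc i j).intervalIntegrable _ _]
  simp only [intervalIntegral.integral_const_mul]
  rw [Matrix.toLpLin_apply]
  simp only [Matrix.mulVec, dotProduct, mixedMatrix, Matrix.of_apply,
    RCLike.inner_apply, conj_trivial, Finset.sum_mul]
  exact Finset.sum_congr rfl fun j _ => by ring

lemma posSemidef_mixedMatrix (hL : Continuous L) {Q : Matrix (Fin d) (Fin d) ℝ}
    (hQ : Q.PosSemidef) : (mixedMatrix L Q).PosSemidef := by
  have hpos := Matrix.isPositive_toEuclideanLin_iff.2 hQ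
  have hsymm : (mixedMatrix L Q).IsHermitian := by
    ext i j
    simp only [Matrix.conjTranspose_apply, star_trivial, mixedMatrix, Matrix.of_apply]
    refine intervalIntegral.integral_congr fun r _ => ?_
    rw [← hpos.isSymmetric, real_inner_comm]
  rw [← Matrix.isPositive_toEuclideanLin_iff]
  refine ⟨Matrix.isSymmetric_toEuclideanLin_iff.2 hsymm, fun p => ?_⟩
  rw [real_inner_comm, RCLike.re_to_real, inner_mixedMatrix hL]
  exact intervalIntegral.integral_nonneg zero_le_one fun r _ => hpos.inner_nonneg_right _

/-- The average over `r ∈ (0, 1]` of the symbols `p ↦ Φ ((L r)ᵀ p)` is the symbol of a Lévy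
triplet. -/
lemma integral_levySymbol_adjoint (hν : IsLevyMeasure ν) (hL : Continuous L)
    (hinj : ∀ r ∈ Icc (0 : ℝ) 1, Function.Injective (L r))
    (Q : Matrix (Fin d) (Fin d) ℝ) (b : EuclideanSpace ℝ (Fin d)) (p : EuclideanSpace ℝ (Fin N)) :
    ∫ r in (0 : ℝ)..1, levySymbol Q b ν ((L r).adjoint p) =
      levySymbol (mixedMatrix L Q) ((∫ r in (0 : ℝ)..1, L r b) -
        ∫ x, truncationDefect L x ∂((volume.restrict (Ioc (0 : ℝ) 1)).prod ν))
        (mixedMeasure L ν) p := by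
  have := hν.sigmaFinite
  have hm := measurable_apply_prod hL
  have hQ : Continuous (Matrix.toEuclideanLin Q) := LinearMap.continuous_of_finiteDimensional _
  set ρ := (volume.restrict (Ioc (0 : ℝ) 1)).prod ν with hρ
  have hadj := continuous_adjoint_apply hL p
  have hK : Integrable (fun x : ℝ × EuclideanSpace ℝ (Fin d) => levyKernel p (L x.1 x.2)) ρ :=
    ((integrable_map_measure (measurable_levyKernel p).aestronglyMeasurable hm.aemeasurable).1
      ((hν.mixedMeasure hL hinj).integrable_levyKernel p))
  have hD := integrable_truncationDefect hν hL
  have hD' : Integrable (fun x => Complex.I * ((inner ℝ p (truncationDefect L x) : ℝ) : ℂ)) ρ :=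
    ((hD.const_inner p).ofReal).const_mul _
  have hsum : Integrable (fun x : ℝ × EuclideanSpace ℝ (Fin d) =>
      levyKernel ((L x.1).adjoint p) x.2) ρ := by
    simp only [levyKernel_adjoint]
    exact hK.add hD'
  have i1 : IntervalIntegrable (fun r => -Complex.I * ((inner ℝ b ((L r).adjoint p) : ℝ) : ℂ))
      volume 0 1 :=
    Continuous.intervalIntegrable (by fun_prop) _ _
  have i2 : IntervalIntegrable (fun r => (1 / 2 : ℂ) * ((inner ℝ ((L r).adjoint p)
      (Matrix.toEuclideanLin Q ((L r).adjoint p)) : ℝ) : ℂ)) volume 0 1 :=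
    Continuous.intervalIntegrable (by fun_prop) _ _
  have i3 : IntervalIntegrable (fun r => ∫ z, levyKernel ((L r).adjoint p) z ∂ν) volume 0 1 :=
    (intervalIntegrable_iff_integrableOn_Ioc_of_le zero_le_one).2 hsum.integral_prod_left
  have e1 : ∫ r in (0 : ℝ)..1, -Complex.I * ((inner ℝ b ((L r).adjoint p) : ℝ) : ℂ) =
      -Complex.I * ((inner ℝ (∫ r in (0 : ℝ)..1, L r b) p : ℝ) : ℂ) := by
    have hLb : Continuous fun r => L r b := hL.clm_apply continuous_const
    rw [intervalIntegral.integral_const_mul, intervalIntegral.integral_ofReal]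
    congr 2
    rw [real_inner_comm, intervalIntegral.integral_of_le zero_le_one,
      intervalIntegral.integral_of_le zero_le_one,
      ← integral_inner ((hLb.intervalIntegrable 0 1).1)]
    refine integral_congr_ae (ae_of_all _ fun r => ?_)
    simp only
    rw [ContinuousLinearMap.adjoint_inner_right, real_inner_comm]
  have e2 : ∫ r in (0 : ℝ)..1, (1 / 2 : ℂ) * ((inner ℝ ((L r).adjoint p)
      (Matrix.toEuclideanLin Q ((L r).adjoint p)) : ℝ) : ℂ) =
      (1 / 2 : ℂ) * ((inner ℝ p (Matrix.toEuclideanLin (mixedMatrix L Q) p) : ℝ) : ℂ) := by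
    rw [intervalIntegral.integral_const_mul, intervalIntegral.integral_ofReal,
      inner_mixedMatrix hL]
  have e3 : ∫ r in (0 : ℝ)..1, ∫ z, levyKernel ((L r).adjoint p) z ∂ν =
      ∫ y, levyKernel p y ∂(mixedMeasure L ν) +
        Complex.I * ((inner ℝ p (∫ x, truncationDefect L x ∂ρ) : ℝ) : ℂ) := by
    rw [intervalIntegral.integral_of_le zero_le_one, ← integral_prod _ hsum, mixedMeasure,
      integral_map hm.aemeasurable (measurable_levyKernel p).aestronglyMeasurable]
    simp only [levyKernel_adjoint]
    rw [integral_add hK hD', integral_const_mul, integral_complex_ofReal,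
      integral_inner hD]
  simp only [levySymbol_eq]
  rw [intervalIntegral.integral_add (i1.add i2) i3, intervalIntegral.integral_add i1 i2, e1, e2, e3,
    inner_sub_left, real_inner_comm p (∫ x, truncationDefect L x ∂ρ)]
  push_cast
  ring

end Transfer

/-! ### Non-degeneracy of the mixed Lévy measure -/

section Nondegeneracy

variable {N d : ℕ} {L : ℝ → EuclideanSpace ℝ (Fin d) →L[ℝ] EuclideanSpace ℝ (Fin N)} {α : ℝ}

lemma exists_le_norm_apply (hL : Continuous L)
    (hinj : ∀ r ∈ Icc (0 : ℝ) 1, Function.Injective (L r)) :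
    ∃ c : ℝ, 0 < c ∧ ∀ r ∈ Icc (0 : ℝ) 1, ∀ z, ‖z‖ = 1 → c ≤ ‖L r z‖ := by
  have hK : IsCompact (Icc (0 : ℝ) 1 ×ˢ Metric.sphere (0 : EuclideanSpace ℝ (Fin d)) 1) :=
    isCompact_Icc.prod (isCompact_sphere _ _)
  have hc : Continuous fun x : ℝ × EuclideanSpace ℝ (Fin d) => ‖L x.1 x.2‖ :=
    ((hL.comp continuous_fst).clm_apply continuous_snd).norm
  obtain ⟨c, hc0, hc⟩ := hK.exists_forall_le' hc.continuousOn (a := 0) (by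
    rintro ⟨r, z⟩ ⟨hr, hz⟩
    have hz' : z ≠ 0 := by
      rintro rfl
      simp at hz
    rw [norm_pos_iff]
    exact (map_ne_zero_iff _ (hinj r hr)).2 hz')
  exact ⟨c, hc0, fun r hr z hz => hc (r, z) ⟨hr, by simpa using hz⟩⟩

/-- The right-hand side is continuous in `p` and positive on the unit sphere by `hker`, hence
bounded below there by compactness; homogeneity of degree `α` does the rest. -/
lemma exists_le_integral_norm_adjoint (hL : Continuous L) (hα : 0 < α)
    (hker : ∀ p, (∀ r ∈ Icc (0 : ℝ) 1, (L r).adjoint p = 0) → p = 0) :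
    ∃ c : ℝ, 0 < c ∧ ∀ p, c * ‖p‖ ^ α ≤ ∫ r in (0 : ℝ)..1, ‖(L r).adjoint p‖ ^ α := by
  have hcont : Continuous fun x : EuclideanSpace ℝ (Fin N) × ℝ => ‖(L x.2).adjoint x.1‖ ^ α := by
    refine Continuous.rpow_const (Continuous.norm ?_) fun _ => Or.inr hα.le
    exact (ContinuousLinearMap.adjoint.continuous.comp (hL.comp continuous_snd)).clm_apply
      continuous_fst
  have hG : Continuous fun p => ∫ r in (0 : ℝ)..1, ‖(L r).adjoint p‖ ^ α :=
    intervalIntegral.continuous_parametric_intervalIntegral_of_continuous' hcont 0 1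
  obtain ⟨c, hc0, hc⟩ := (isCompact_sphere (0 : EuclideanSpace ℝ (Fin N)) 1).exists_forall_le'
    hG.continuousOn (a := 0) (by
      intro p hp
      have hp0 : p ≠ 0 := by
        rintro rfl
        simp at hp
      refine intervalIntegral.integral_pos one_pos
        (hcont.comp (continuous_const.prodMk continuous_id)).continuousOn
        (fun r _ => by positivity) ?_
      by_contra hcon
      push Not at hcon
      refine hp0 (hker p fun r hr => ?_)
      by_contra hne
      exact absurd (hcon r hr) (not_le.2 (Real.rpow_pos_of_pos (norm_pos_iff.2 hne) _)))
  refine ⟨c, hc0, fun p => ?_⟩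
  rcases eq_or_ne p 0 with rfl | hp
  · simp [Real.zero_rpow hα.ne']
  · have h1 := hc (‖p‖⁻¹ • p) (by simp [norm_smul, hp])
    have h2 : ∀ r, ‖(L r).adjoint (‖p‖⁻¹ • p)‖ ^ α = (‖p‖ ^ α)⁻¹ * ‖(L r).adjoint p‖ ^ α :=
      fun r => by
        rw [map_smul, norm_smul, norm_inv, norm_norm, Real.mul_rpow (by positivity) (by positivity),
          Real.inv_rpow (norm_nonneg _)]
    simp only [h2, intervalIntegral.integral_const_mul] at h1
    rwa [le_inv_mul_iff₀ (by positivity), mul_comm] at h1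

/-- The direction of `L r θ`. -/
def imageDirection (L : ℝ → EuclideanSpace ℝ (Fin d) →L[ℝ] EuclideanSpace ℝ (Fin N))
    (x : ℝ × Metric.sphere (0 : EuclideanSpace ℝ (Fin d)) 1) : EuclideanSpace ℝ (Fin N) :=
  ‖L x.1 x.2‖⁻¹ • L x.1 x.2

/-- The spherical part of the polar measures that are mapped by the `L r`. -/
def imageSphereMeasure (α : ℝ)
    (L : ℝ → EuclideanSpace ℝ (Fin d) →L[ℝ] EuclideanSpace ℝ (Fin N))
    (μ : Measure (Metric.sphere (0 : EuclideanSpace ℝ (Fin d)) 1)) :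
    Measure (Metric.sphere (0 : EuclideanSpace ℝ (Fin N)) 1) :=
  ((((volume.restrict (Ioc (0 : ℝ) 1)).prod μ).withDensity fun x =>
    ENNReal.ofReal (‖L x.1 x.2‖ ^ α)).map (imageDirection L)).comap Subtype.val

variable {μ : Measure (Metric.sphere (0 : EuclideanSpace ℝ (Fin d)) 1)}

lemma measurable_apply_sphere (hL : Continuous L) :
    Measurable fun x : ℝ × Metric.sphere (0 : EuclideanSpace ℝ (Fin d)) 1 => L x.1 x.2 :=
  ((hL.comp continuous_fst).clm_apply (continuous_subtype_val.comp continuous_snd)).measurable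

lemma measurable_imageDirection (hL : Continuous L) : Measurable (imageDirection L) :=
  (measurable_apply_sphere hL).norm.inv.smul (measurable_apply_sphere hL)

lemma ae_apply_sphere_ne_zero [IsFiniteMeasure μ]
    (hinj : ∀ r ∈ Icc (0 : ℝ) 1, Function.Injective (L r)) :
    ∀ᵐ x ∂((volume.restrict (Ioc (0 : ℝ) 1)).prod μ), L x.1 x.2 ≠ 0 := by
  have h : ∀ᵐ x ∂((volume.restrict (Ioc (0 : ℝ) 1)).prod μ), x.1 ∈ Ioc (0 : ℝ) 1 :=
    Measure.quasiMeasurePreserving_fst.ae (ae_restrict_mem measurableSet_Ioc)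
  filter_upwards [h] with x hx
  refine (map_ne_zero_iff _ (hinj _ (Ioc_subset_Icc_self hx))).2 fun h0 => ?_
  have := x.2.2
  simp [h0] at this

/-- Restricting to the sphere loses no mass: `L r θ ≠ 0` almost everywhere, so its direction is a
unit vector. -/
lemma lintegral_imageSphereMeasure [IsFiniteMeasure μ] (hL : Continuous L)
    (hinj : ∀ r ∈ Icc (0 : ℝ) 1, Function.Injective (L r))
    {f : EuclideanSpace ℝ (Fin N) → ℝ≥0∞} (hf : Measurable f) :
    ∫⁻ s, f s ∂(imageSphereMeasure α L μ) =
      ∫⁻ x, ENNReal.ofReal (‖L x.1 x.2‖ ^ α) * f (imageDirection L x)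
        ∂((volume.restrict (Ioc (0 : ℝ) 1)).prod μ) := by
  have hw : Measurable fun x : ℝ × Metric.sphere (0 : EuclideanSpace ℝ (Fin d)) 1 =>
      ENNReal.ofReal (‖L x.1 x.2‖ ^ α) :=
    ((measurable_apply_sphere hL).norm.pow_const α).ennreal_ofReal
  have hT := measurable_imageDirection hL
  have hemb : MeasurableEmbedding
      (Subtype.val : Metric.sphere (0 : EuclideanSpace ℝ (Fin N)) 1 → _) :=
    MeasurableEmbedding.subtype_coe Metric.isClosed_sphere.measurableSet
  rw [imageSphereMeasure, ← hemb.lintegral_map, hemb.map_comap, Subtype.range_coe,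
    Measure.restrict_eq_self_of_ae_mem, lintegral_map hf hT,
    lintegral_withDensity_eq_lintegral_mul _ hw
      (show Measurable fun x => f (imageDirection L x) from hf.comp hT)]
  · rfl
  · refine (ae_map_iff hT.aemeasurable Metric.isClosed_sphere.measurableSet).2 ?_
    refine (withDensity_absolutelyContinuous _ _).ae_le ?_
    filter_upwards [ae_apply_sphere_ne_zero hinj] with x hx
    simp [imageDirection, norm_smul, hx]

lemma isFiniteMeasure_imageSphereMeasure [IsFiniteMeasure μ] (hL : Continuous L) (hα : 0 < α)
    (hinj : ∀ r ∈ Icc (0 : ℝ) 1, Function.Injective (L r)) :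
    IsFiniteMeasure (imageSphereMeasure α L μ) := by
  obtain ⟨C, hC, hLC⟩ := exists_norm_le hL
  have h := lintegral_imageSphereMeasure (α := α) (μ := μ) hL hinj (f := fun _ => 1)
    measurable_const
  refine ⟨?_⟩
  rw [← lintegral_one, h]
  refine (lintegral_mono_ae (g := fun _ => ENNReal.ofReal (C ^ α)) ?_).trans_lt ?_
  · have h : ∀ᵐ x ∂((volume.restrict (Ioc (0 : ℝ) 1)).prod μ), x.1 ∈ Ioc (0 : ℝ) 1 :=
      Measure.quasiMeasurePreserving_fst.ae (ae_restrict_mem measurableSet_Ioc)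
    filter_upwards [h] with x hx
    rw [mul_one]
    refine ENNReal.ofReal_le_ofReal (Real.rpow_le_rpow (norm_nonneg _) ?_ hα.le)
    simpa using hLC _ hx x.2
  · rw [lintegral_const]
    exact ENNReal.mul_lt_top ENNReal.ofReal_lt_top (measure_lt_top _ _)

lemma integrable_abs_inner_rpow [IsFiniteMeasure μ] (hα : 0 < α) (q : EuclideanSpace ℝ (Fin d)) :
    Integrable (fun s : Metric.sphere (0 : EuclideanSpace ℝ (Fin d)) 1 =>
      |inner ℝ q (s : EuclideanSpace ℝ (Fin d))| ^ α) μ := by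
  refine Integrable.of_bound (C := ‖q‖ ^ α) ?_ (ae_of_all _ fun s => ?_)
  · refine Measurable.aestronglyMeasurable (Measurable.pow_const ?_ α)
    exact (continuous_const.inner continuous_subtype_val).abs.measurable
  · rw [Real.norm_of_nonneg (by positivity)]
    refine Real.rpow_le_rpow (abs_nonneg _) ?_ hα.le
    simpa using abs_real_inner_le_norm q s

/-- The weight `‖L r θ‖^α` cancels the normalisation of the direction, and the adjoint moves `L r`
onto `p`. -/
lemma lintegral_abs_inner_imageSphereMeasure [IsFiniteMeasure μ] (hL : Continuous L) (hα : 0 < α)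
    (hinj : ∀ r ∈ Icc (0 : ℝ) 1, Function.Injective (L r)) (p : EuclideanSpace ℝ (Fin N)) :
    ∫⁻ s, ENNReal.ofReal (|inner ℝ p (s : EuclideanSpace ℝ (Fin N))| ^ α)
        ∂(imageSphereMeasure α L μ) =
      ∫⁻ r in Ioc (0 : ℝ) 1, ENNReal.ofReal
        (∫ θ, |inner ℝ ((L r).adjoint p) (θ : EuclideanSpace ℝ (Fin d))| ^ α ∂μ) := by
  have hmeas : Measurable fun x : ℝ × Metric.sphere (0 : EuclideanSpace ℝ (Fin d)) 1 =>
      ENNReal.ofReal (|inner ℝ p (L x.1 x.2)| ^ α) :=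
    ((continuous_abs.measurable.comp (measurable_apply_sphere hL).const_inner).pow_const
      α).ennreal_ofReal
  rw [lintegral_imageSphereMeasure hL hinj
    (f := fun s => ENNReal.ofReal (|inner ℝ p s| ^ α)) (by fun_prop)]
  have h1 : ∀ᵐ x ∂((volume.restrict (Ioc (0 : ℝ) 1)).prod μ),
      ENNReal.ofReal (‖L x.1 x.2‖ ^ α) *
        ENNReal.ofReal (|inner ℝ p (imageDirection L x)| ^ α) =
      ENNReal.ofReal (|inner ℝ p (L x.1 x.2)| ^ α) := by
    filter_upwards [ae_apply_sphere_ne_zero hinj] with x hx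
    rw [← ENNReal.ofReal_mul (by positivity), ← Real.mul_rpow (norm_nonneg _) (abs_nonneg _),
      imageDirection, real_inner_smul_right, abs_mul, abs_of_nonneg (by positivity),
      mul_inv_cancel_left₀ (norm_ne_zero_iff.2 hx)]
  rw [lintegral_congr_ae h1, lintegral_prod _ hmeas.aemeasurable]
  refine lintegral_congr fun r => ?_
  rw [ofReal_integral_eq_lintegral_ofReal (integrable_abs_inner_rpow hα _)
    (ae_of_all _ fun _ => by positivity)]
  simp only [ContinuousLinearMap.adjoint_inner_left]

lemma isNondegenerateOnSphere_imageSphereMeasure [IsFiniteMeasure μ] (hL : Continuous L)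
    (hα : 0 < α) (hinj : ∀ r ∈ Icc (0 : ℝ) 1, Function.Injective (L r))
    (hker : ∀ p, (∀ r ∈ Icc (0 : ℝ) 1, (L r).adjoint p = 0) → p = 0)
    (hμ : IsNondegenerateOnSphere α μ) :
    IsNondegenerateOnSphere α (imageSphereMeasure α L μ) := by
  have := isFiniteMeasure_imageSphereMeasure (μ := μ) hL hα hinj
  obtain ⟨η, hη, hημ⟩ := hμ
  obtain ⟨C, hC, hLC⟩ := exists_norm_le hL
  obtain ⟨c, hc, hcG⟩ := exists_le_integral_norm_adjoint hL hα hker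
  have hη0 : 0 < η := one_pos.trans_le hη
  -- `η * C ^ α` is the upper constant, with `‖(L r)ᵀ‖ = ‖L r‖ ≤ C`; `η / c` is the inverse of the
  -- lower constant `η⁻¹ * c`.
  refine ⟨max (max 1 (η * C ^ α)) (η / c), (le_max_left _ _).trans (le_max_left _ _), fun p => ?_⟩
  have hcont : Continuous fun r : ℝ => η⁻¹ * ‖(L r).adjoint p‖ ^ α :=
    continuous_const.mul (Continuous.rpow_const (continuous_adjoint_apply hL p).norm
      fun _ => Or.inr hα.le)
  have hlow : ENNReal.ofReal (η⁻¹ * (c * ‖p‖ ^ α)) ≤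
      ∫⁻ s, ENNReal.ofReal (|inner ℝ p (s : EuclideanSpace ℝ (Fin N))| ^ α)
        ∂(imageSphereMeasure α L μ) := by
    rw [lintegral_abs_inner_imageSphereMeasure hL hα hinj]
    calc ENNReal.ofReal (η⁻¹ * (c * ‖p‖ ^ α))
        ≤ ENNReal.ofReal (∫ r in Ioc (0 : ℝ) 1, η⁻¹ * ‖(L r).adjoint p‖ ^ α) := by
          refine ENNReal.ofReal_le_ofReal ?_
          rw [integral_const_mul, ← intervalIntegral.integral_of_le zero_le_one]
          exact mul_le_mul_of_nonneg_left (hcG p) (by positivity)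
      _ = ∫⁻ r in Ioc (0 : ℝ) 1, ENNReal.ofReal (η⁻¹ * ‖(L r).adjoint p‖ ^ α) :=
          ofReal_integral_eq_lintegral_ofReal ((hcont.intervalIntegrable 0 1).1)
            (ae_of_all _ fun _ => by positivity)
      _ ≤ _ := lintegral_mono fun r => ENNReal.ofReal_le_ofReal (hημ _).1
  have hup : ∫⁻ s, ENNReal.ofReal (|inner ℝ p (s : EuclideanSpace ℝ (Fin N))| ^ α)
        ∂(imageSphereMeasure α L μ) ≤ ENNReal.ofReal (η * C ^ α * ‖p‖ ^ α) := by
    rw [lintegral_abs_inner_imageSphereMeasure hL hα hinj]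
    calc ∫⁻ r in Ioc (0 : ℝ) 1, ENNReal.ofReal
          (∫ θ, |inner ℝ ((L r).adjoint p) (θ : EuclideanSpace ℝ (Fin d))| ^ α ∂μ)
        ≤ ∫⁻ r in Ioc (0 : ℝ) 1, ENNReal.ofReal (η * C ^ α * ‖p‖ ^ α) := by
          refine setLIntegral_mono measurable_const fun r hr => ENNReal.ofReal_le_ofReal ?_
          refine (hημ _).2.trans ?_
          rw [mul_assoc, ← Real.mul_rpow (by positivity) (norm_nonneg _)]
          refine mul_le_mul_of_nonneg_left (Real.rpow_le_rpow (norm_nonneg _) ?_ hα.le) hη0.le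
          refine ((L r).adjoint.le_opNorm p).trans
            (mul_le_mul_of_nonneg_right ?_ (norm_nonneg _))
          rw [LinearIsometryEquiv.norm_map]
          exact (L r).opNorm_le_bound (by positivity) fun z => hLC r hr z
      _ = _ := by simp
  have hint := integral_eq_lintegral_of_nonneg_ae (μ := imageSphereMeasure α L μ)
    (ae_of_all _ fun s => by positivity)
    (integrable_abs_inner_rpow (μ := imageSphereMeasure α L μ) hα p).aestronglyMeasurable
  rw [hint]
  have hpα : 0 ≤ ‖p‖ ^ α := by positivity
  constructor
  · refine le_trans ?_ ((ENNReal.ofReal_le_iff_le_toReal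
      (hup.trans_lt ENNReal.ofReal_lt_top).ne).1 hlow)
    rw [← mul_assoc]
    refine mul_le_mul_of_nonneg_right ?_ hpα
    rw [inv_le_comm₀ (by positivity) (by positivity)]
    refine le_trans (le_of_eq ?_) (le_max_right _ _)
    rw [mul_inv, inv_inv, div_eq_mul_inv]
  · refine (ENNReal.toReal_le_of_le_ofReal (by positivity) hup).trans ?_
    exact mul_le_mul_of_nonneg_right ((le_max_right _ _).trans (le_max_left _ _)) hpα

/-- Substitute `‖y‖ρ` for `ρ`: the Jacobian `‖y‖` and the weight `‖y‖^α` exactly absorb the scaling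
of `ρ^{-(1+α)}`. The range becomes `(0, c r₀ / ‖y‖]`, contained in `(0, r₀]` because `c ≤ ‖y‖`; this
inclusion is the only loss. -/
lemma lintegral_Ioc_scaling {C : Set (EuclideanSpace ℝ (Fin N))} {c r₀ : ℝ} (hc : 0 < c)
    (hr₀ : 0 < r₀) {y : EuclideanSpace ℝ (Fin N)} (hy : c ≤ ‖y‖) :
    ∫⁻ ρ in Ioc (0 : ℝ) (c * r₀), ENNReal.ofReal (‖y‖ ^ α) *
        C.indicator (fun _ => (1 : ℝ≥0∞)) (ρ • ‖y‖⁻¹ • y) * ENNReal.ofReal (1 / ρ ^ (1 + α)) ≤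
      ∫⁻ ρ in Ioc (0 : ℝ) r₀, C.indicator (fun _ => (1 : ℝ≥0∞)) (ρ • y) *
        ENNReal.ofReal (1 / ρ ^ (1 + α)) := by
  have hl : 0 < ‖y‖ := hc.trans_le hy
  have himg : (fun ρ => ‖y‖ * ρ) '' Ioc (0 : ℝ) (c * r₀ / ‖y‖) = Ioc 0 (c * r₀) := by
    rw [Set.image_mul_left_Ioc hl, mul_zero, mul_div_cancel₀ _ hl.ne']
  rw [← himg, lintegral_image_eq_lintegral_abs_deriv_mul measurableSet_Ioc
    (f' := fun _ => ‖y‖) (fun ρ _ => by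
      simpa using ((hasDerivAt_id ρ).const_mul ‖y‖).hasDerivWithinAt)
    (mul_right_injective₀ hl.ne').injOn]
  have hsub : Ioc (0 : ℝ) (c * r₀ / ‖y‖) ⊆ Ioc 0 r₀ := Ioc_subset_Ioc_right (by
    rw [div_le_iff₀ hl, mul_comm r₀]
    exact mul_le_mul_of_nonneg_right hy hr₀.le)
  refine le_trans (le_of_eq ?_) (lintegral_mono_set hsub)
  refine setLIntegral_congr_fun measurableSet_Ioc fun ρ hρ => ?_
  have h1 : (‖y‖ * ρ) • ‖y‖⁻¹ • y = ρ • y := by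
    rw [smul_smul]
    congr 1
    field_simp
  rw [h1, mul_comm (ENNReal.ofReal (‖y‖ ^ α)), mul_assoc, mul_left_comm,
    ← ENNReal.ofReal_mul (by positivity), ← ENNReal.ofReal_mul (by positivity)]
  congr 2
  rw [abs_of_pos hl, Real.mul_rpow hl.le hρ.1.le, Real.rpow_add hl, Real.rpow_one]
  have : ‖y‖ ^ α ≠ 0 := (Real.rpow_pos_of_pos hl _).ne'
  field_simp

set_option maxHeartbeats 800000 in
/-- Condition [ND] is preserved by mixing along a curve of injective linear maps whose ranges span
the whole space. -/
theorem ConditionND.mixedMeasure {ν : Measure (EuclideanSpace ℝ (Fin d))} [SFinite ν]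
    (hND : ConditionND α ν) (hL : Continuous L) (hα : 0 < α)
    (hinj : ∀ r ∈ Icc (0 : ℝ) 1, Function.Injective (L r))
    (hker : ∀ p, (∀ r ∈ Icc (0 : ℝ) 1, (L r).adjoint p = 0) → p = 0) :
    ConditionND α (mixedMeasure L ν) := by
  obtain ⟨r₀, hr₀, μ, hμ, hμα, hdom⟩ := hND
  obtain ⟨c, hc, hcL⟩ := exists_le_norm_apply hL hinj
  refine ⟨c * r₀, by positivity, imageSphereMeasure α L μ,
    isFiniteMeasure_imageSphereMeasure hL hα hinj,
    isNondegenerateOnSphere_imageSphereMeasure hL hα hinj hker hμα, fun C hC h0C => ?_⟩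
  have hind : Measurable (C.indicator fun _ => (1 : ℝ≥0∞)) := measurable_const.indicator hC
  have hk : Measurable fun ρ : ℝ => ENNReal.ofReal (1 / ρ ^ (1 + α)) := by fun_prop
  have hw : Measurable fun x : ℝ × Metric.sphere (0 : EuclideanSpace ℝ (Fin d)) 1 =>
      ENNReal.ofReal (‖L x.1 x.2‖ ^ α) :=
    ((measurable_apply_sphere hL).norm.pow_const α).ennreal_ofReal
  have hT := measurable_imageDirection hL
  have hAp := measurable_apply_sphere hL
  have hF : Measurable fun z : ℝ × (ℝ × Metric.sphere (0 : EuclideanSpace ℝ (Fin d)) 1) =>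
      ENNReal.ofReal (‖L z.2.1 z.2.2‖ ^ α) * C.indicator (fun _ => (1 : ℝ≥0∞))
        (z.1 • imageDirection L z.2) :=
    (hw.comp measurable_snd).mul (hind.comp (measurable_fst.smul (hT.comp measurable_snd)))
  have hG : Measurable fun z : (ℝ × Metric.sphere (0 : EuclideanSpace ℝ (Fin d)) 1) × ℝ =>
      C.indicator (fun _ => (1 : ℝ≥0∞)) (z.2 • L z.1.1 z.1.2) *
        ENNReal.ofReal (1 / z.2 ^ (1 + α)) :=
    (hind.comp (measurable_snd.smul (hAp.comp measurable_fst))).mul (hk.comp measurable_snd)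
  set ρ₁ := volume.restrict (Ioc (0 : ℝ) 1)
  calc ∫⁻ ρ in Ioc (0 : ℝ) (c * r₀),
        (∫⁻ s, C.indicator (fun _ => (1 : ℝ≥0∞)) (ρ • (s : EuclideanSpace ℝ (Fin N)))
          ∂(imageSphereMeasure α L μ)) * ENNReal.ofReal (1 / ρ ^ (1 + α))
      = ∫⁻ ρ in Ioc (0 : ℝ) (c * r₀), ∫⁻ x, ENNReal.ofReal (‖L x.1 x.2‖ ^ α) *
          C.indicator (fun _ => (1 : ℝ≥0∞)) (ρ • imageDirection L x) *
            ENNReal.ofReal (1 / ρ ^ (1 + α)) ∂(ρ₁.prod μ) := by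
        refine lintegral_congr fun ρ => ?_
        have h1 := lintegral_imageSphereMeasure (α := α) (μ := μ) hL hinj
          (f := fun s => C.indicator (fun _ => (1 : ℝ≥0∞)) (ρ • s))
          (hind.comp (measurable_const_smul ρ))
        have h2 : Measurable fun x : ℝ × Metric.sphere (0 : EuclideanSpace ℝ (Fin d)) 1 => ENNReal.ofReal (‖L x.1 x.2‖ ^ α) *
            C.indicator (fun _ => (1 : ℝ≥0∞)) (ρ • imageDirection L x) :=
          hw.mul (hind.comp (hT.const_smul ρ))
        exact (congrArg (· * ENNReal.ofReal (1 / ρ ^ (1 + α))) h1).trans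
          (lintegral_mul_const _ h2).symm
    _ = ∫⁻ x, (∫⁻ ρ in Ioc (0 : ℝ) (c * r₀), ENNReal.ofReal (‖L x.1 x.2‖ ^ α) *
          C.indicator (fun _ => (1 : ℝ≥0∞)) (ρ • imageDirection L x) *
            ENNReal.ofReal (1 / ρ ^ (1 + α))) ∂(ρ₁.prod μ) :=
        lintegral_lintegral_swap (hF.mul (hk.comp measurable_fst)).aemeasurable
    _ ≤ ∫⁻ x, (∫⁻ ρ in Ioc (0 : ℝ) r₀, C.indicator (fun _ => (1 : ℝ≥0∞)) (ρ • L x.1 x.2) *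
          ENNReal.ofReal (1 / ρ ^ (1 + α))) ∂(ρ₁.prod μ) := by
        have h : ∀ᵐ x ∂(ρ₁.prod μ), x.1 ∈ Ioc (0 : ℝ) 1 :=
          Measure.quasiMeasurePreserving_fst.ae (ae_restrict_mem measurableSet_Ioc)
        refine lintegral_mono_ae ?_
        filter_upwards [h] with x hx
        exact lintegral_Ioc_scaling hc hr₀ (hcL _ (Ioc_subset_Icc_self hx) _ (by simp))
    _ = ∫⁻ r, (∫⁻ θ, (∫⁻ ρ in Ioc (0 : ℝ) r₀,
          C.indicator (fun _ => (1 : ℝ≥0∞)) (ρ • L r (θ : EuclideanSpace ℝ (Fin d))) *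
            ENNReal.ofReal (1 / ρ ^ (1 + α))) ∂μ) ∂ρ₁ :=
        lintegral_prod _ hG.lintegral_prod_right'.aemeasurable
    _ ≤ ∫⁻ r, ν (L r ⁻¹' C) ∂ρ₁ := by
        refine lintegral_mono fun r => ?_
        have hGr : Measurable fun z : Metric.sphere (0 : EuclideanSpace ℝ (Fin d)) 1 × ℝ =>
            C.indicator (fun _ => (1 : ℝ≥0∞)) (z.2 • L r (z.1 : EuclideanSpace ℝ (Fin d))) *
              ENNReal.ofReal (1 / z.2 ^ (1 + α)) :=
          hG.comp ((measurable_const.prodMk measurable_fst).prodMk measurable_snd)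
        rw [lintegral_lintegral_swap hGr.aemeasurable]
        -- For each fixed `r`, the minorisation of `ν` is applied to the preimage of `C`, which
        -- misses `0` since `C` does.
        refine le_trans (le_of_eq ?_) (hdom (L r ⁻¹' C) ((L r).continuous.measurable hC)
          (by simpa using h0C))
        refine lintegral_congr fun ρ => ?_
        have h3 : Measurable fun θ : Metric.sphere (0 : EuclideanSpace ℝ (Fin d)) 1 =>
            C.indicator (fun _ => (1 : ℝ≥0∞)) (ρ • L r (θ : EuclideanSpace ℝ (Fin d))) :=
          hind.comp (((L r).continuous.measurable.comp measurable_subtype_coe).const_smul ρ)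
        rw [lintegral_mul_const _ h3]
        congr 1
        refine lintegral_congr fun θ => ?_
        have hiff : ρ • (θ : EuclideanSpace ℝ (Fin d)) ∈ L r ⁻¹' C ↔
            ρ • L r (θ : EuclideanSpace ℝ (Fin d)) ∈ C := by
          rw [Set.mem_preimage, map_smul]
        by_cases h : ρ • L r (θ : EuclideanSpace ℝ (Fin d)) ∈ C
        · rw [indicator_of_mem h, indicator_of_mem (hiff.2 h)]
        · rw [indicator_of_notMem h, indicator_of_notMem (mt hiff.1 h)]
    _ = _root_.mixedMeasure L ν C := by
        rw [_root_.mixedMeasure, Measure.map_apply (measurable_apply_prod hL) hC,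
          Measure.prod_apply (measurable_apply_prod hL hC)]
        rfl

end Nondegeneracy

/-! ### Stochastic Riemann sums -/

section Riemann

/-- Uniform continuity on `[0, 1]` bounds the error on each cell by `ε / 2` times its length. -/
lemma tendsto_riemann_sum {h : ℝ → ℂ} (hh : Continuous h) :
    Tendsto (fun n : ℕ => ∑ i ∈ Finset.range (n + 1), (1 / (n + 1 : ℝ) : ℂ) * h (i / (n + 1)))
      atTop (𝓝 (∫ r in (0 : ℝ)..1, h r)) := by
  rw [Metric.tendsto_atTop]
  intro ε hε
  obtain ⟨δ, hδ, hδh⟩ := Metric.uniformContinuousOn_iff.1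
    ((isCompact_Icc (a := (0 : ℝ)) (b := 1)).uniformContinuousOn_of_continuous hh.continuousOn)
    (ε / 2) (half_pos hε)
  obtain ⟨n₀, hn₀⟩ := exists_nat_one_div_lt hδ
  refine ⟨n₀, fun n hn => ?_⟩
  have hn1 : (0 : ℝ) < n + 1 := by positivity
  have hmesh : 1 / ((n : ℝ) + 1) < δ := lt_of_le_of_lt (by gcongr) hn₀
  have hsplit := intervalIntegral.sum_integral_adjacent_intervals (μ := volume) (f := h)
    (a := fun i : ℕ => (i : ℝ) / (n + 1)) (n := n + 1) fun k _ => hh.intervalIntegrable _ _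
  simp only [Nat.cast_zero, zero_div, Nat.cast_add, Nat.cast_one, div_self hn1.ne'] at hsplit
  rw [← hsplit, dist_eq_norm, ← Finset.sum_sub_distrib]
  refine (norm_sum_le _ _).trans_lt ?_
  have hterm : ∀ i ∈ Finset.range (n + 1), ‖(1 / (n + 1 : ℝ) : ℂ) * h (i / (n + 1)) -
      ∫ x in (i : ℝ) / (n + 1)..((i : ℝ) + 1) / (n + 1), h x‖ ≤ ε / 2 * (1 / (n + 1)) := by
    intro i hi
    have hi' : (i : ℝ) + 1 ≤ n + 1 := by
      have := Finset.mem_range.1 hi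
      exact_mod_cast this
    have hlen : ((i : ℝ) + 1) / (n + 1) - i / (n + 1) = 1 / (n + 1) := by ring
    have hle : (i : ℝ) / (n + 1) ≤ ((i : ℝ) + 1) / (n + 1) := by gcongr; linarith
    have hconst : (1 / (n + 1 : ℝ) : ℂ) * h (i / (n + 1)) =
        ∫ _ in (i : ℝ) / (n + 1)..((i : ℝ) + 1) / (n + 1), h (i / (n + 1)) := by
      rw [intervalIntegral.integral_const, hlen, Complex.real_smul]
      push_cast
      ring
    rw [hconst, ← intervalIntegral.integral_sub (by simp) (hh.intervalIntegrable _ _)]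
    refine (intervalIntegral.norm_integral_le_of_norm_le_const (C := ε / 2) fun x hx => ?_).trans_eq
      (by rw [hlen, abs_of_pos (by positivity)])
    rw [uIoc_of_le hle] at hx
    have h0 : (0 : ℝ) ≤ i / (n + 1) := by positivity
    have h1 : ((i : ℝ) + 1) / (n + 1) ≤ 1 := (div_le_one hn1).2 hi'
    rw [← dist_eq_norm]
    refine (hδh _ ⟨h0, hle.trans h1⟩ _ ⟨h0.trans hx.1.le, hx.2.trans h1⟩ ?_).le
    rw [Real.dist_eq, abs_sub_comm, abs_of_nonneg (by linarith [hx.1])]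
    linarith [hx.2]
  refine (Finset.sum_le_sum hterm).trans_lt ?_
  rw [Finset.sum_const, Finset.card_range, nsmul_eq_mul]
  push_cast
  have : ((n : ℝ) + 1) * (ε / 2 * (1 / (n + 1))) = ε / 2 := by field_simp
  rw [this]
  exact half_lt_self hε

lemma charFun_map_clm {E F Ω : Type*} [NormedAddCommGroup E] [InnerProductSpace ℝ E]
    [CompleteSpace E] [MeasurableSpace E] [BorelSpace E] [SecondCountableTopology E]
    [NormedAddCommGroup F] [InnerProductSpace ℝ F] [CompleteSpace F] [MeasurableSpace F]
    [BorelSpace F] [SecondCountableTopology F] [MeasurableSpace Ω] {P : Measure Ω} {Y : Ω → E}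
    (hY : AEMeasurable Y P) (T : E →L[ℝ] F) (p : F) :
    charFun (P.map fun ω => T (Y ω)) p = charFun (P.map Y) (T.adjoint p) := by
  rw [charFun_apply, charFun_apply, integral_map
    (show AEMeasurable (fun ω => T (Y ω)) P from T.measurable.comp_aemeasurable hY) (by fun_prop),
    integral_map hY (by fun_prop)]
  simp only [ContinuousLinearMap.adjoint_inner_right]

/-- A pointwise limit of characteristic functions that is continuous at `0` is a characteristic
function. -/
lemma exists_charFun_eq_of_tendsto {E : Type*} [NormedAddCommGroup E] [InnerProductSpace ℝ E]
    [FiniteDimensional ℝ E] [MeasurableSpace E] [BorelSpace E] {μ : ℕ → Measure E}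
    [∀ n, IsProbabilityMeasure (μ n)] {f : E → ℂ} (hf : ContinuousAt f 0)
    (h : ∀ p, Tendsto (fun n => charFun (μ n) p) atTop (𝓝 (f p))) :
    ∃ μ' : Measure E, IsProbabilityMeasure μ' ∧ ∀ p, charFun μ' p = f p := by
  let ν : ℕ → ProbabilityMeasure E := fun n => ⟨μ n, inferInstance⟩
  have htight : IsTightMeasureSet {((κ : ProbabilityMeasure E) : Measure E) | κ ∈ range ν} := by
    convert! isTightMeasureSet_of_tendsto_charFun hf h using 1
    ext κ
    constructor
    · rintro ⟨_, ⟨n, rfl⟩, rfl⟩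
      exact ⟨n, rfl⟩
    · rintro ⟨n, rfl⟩
      exact ⟨ν n, ⟨n, rfl⟩, rfl⟩
  have hcomp : IsCompact (closure (range ν)) := isCompact_closure_of_isTightMeasureSet htight
  let U : Ultrafilter ℕ := hyperfilter ℕ
  obtain ⟨μ', -, hμ'⟩ := hcomp.ultrafilter_le_nhds (U.map ν)
    (le_principal_iff.2 (Filter.mem_map.2
      (Filter.univ_mem' fun n => subset_closure (mem_range_self n))))
  have hU : Tendsto ν U (𝓝 μ') := hμ'
  refine ⟨μ', inferInstance, fun p => ?_⟩
  rw [ProbabilityMeasure.tendsto_iff_forall_integral_rclike_tendsto ℂ] at hU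
  have h1 : Tendsto (fun n => charFun (μ n) p) U (𝓝 (charFun (μ' : Measure E) p)) := by
    simp_rw [charFun_eq_integral_innerProbChar]
    exact hU (BoundedContinuousFunction.innerProbChar p)
  exact tendsto_nhds_unique h1 ((h p).mono_left Nat.hyperfilter_le_atTop)

variable {N d : ℕ} {L : ℝ → EuclideanSpace ℝ (Fin d) →L[ℝ] EuclideanSpace ℝ (Fin N)}
  {Q : Matrix (Fin d) (Fin d) ℝ} {b : EuclideanSpace ℝ (Fin d)}
  {ν : Measure (EuclideanSpace ℝ (Fin d))} {Ω : Type*} [MeasurableSpace Ω] {P : Measure Ω}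
  {Z : ℝ≥0 → Ω → EuclideanSpace ℝ (Fin d)}

/-- The Riemann sum of `∫₀ᵘ L (s / u) dZ_s` with `n + 1` steps. -/
def stochRiemannSum (L : ℝ → EuclideanSpace ℝ (Fin d) →L[ℝ] EuclideanSpace ℝ (Fin N))
    (Z : ℝ≥0 → Ω → EuclideanSpace ℝ (Fin d)) (u : ℝ≥0) (n : ℕ) (ω : Ω) :
    EuclideanSpace ℝ (Fin N) :=
  ∑ i ∈ Finset.range (n + 1), L (i / (n + 1))
    (Z (u * ((i + 1 : ℕ) / (n + 1))) ω - Z (u * ((i : ℕ) / (n + 1))) ω)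

lemma measurable_stochRiemannSum (hZ : ∀ u, Measurable (Z u)) (u : ℝ≥0) (n : ℕ) :
    Measurable (stochRiemannSum L Z u n) :=
  Finset.measurable_fun_sum _ fun _ _ => (L _).measurable.comp ((hZ _).sub (hZ _))

/-- The summands are independent images of increments over steps of length `u / (n + 1)`, so the
exponent is a Riemann sum of the averaged symbol. -/
lemma IsLevyProcessWithTriplet.charFun_stochRiemannSum [IsProbabilityMeasure P]
    (hZ : IsLevyProcessWithTriplet P Z Q b ν) (u : ℝ≥0) (n : ℕ)
    (p : EuclideanSpace ℝ (Fin N)) :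
    charFun (P.map (stochRiemannSum L Z u n)) p =
      Complex.exp (-((u : ℝ) : ℂ) * ∑ i ∈ Finset.range (n + 1), (1 / (n + 1 : ℝ) : ℂ) *
        levySymbol Q b ν ((L (i / (n + 1))).adjoint p)) := by
  have hm := hZ.isLevyProcess.measurable
  set τ : ℕ → ℝ≥0 := fun i => u * ((i : ℕ) / (n + 1)) with hτ
  have hmono : Monotone τ := fun i j hij => by
    simp only [hτ]
    gcongr
  have hind := hZ.isLevyProcess.indep_increments.nat hmono
  have hind2 : iIndepFun (fun (i : ℕ) ω => L (i / (n + 1)) (Z (τ (i + 1)) ω - Z (τ i) ω)) P :=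
    hind.comp (fun i => L (i / (n + 1))) fun i => (L _).measurable
  have hprod := iIndepFun.charFun_map_fun_finsetSum_eq_prod (s := Finset.range (n + 1))
    (fun i _ => ((L _).measurable.comp ((hm _).sub (hm _))).aemeasurable) (hind2.restrict _)
  have h1 : charFun (P.map (stochRiemannSum L Z u n)) p =
      ∏ i ∈ Finset.range (n + 1),
        charFun (P.map fun ω => L (i / (n + 1)) (Z (τ (i + 1)) ω - Z (τ i) ω)) p := by
    have := congrFun hprod p
    rw [Finset.prod_apply] at this
    exact this
  rw [h1, Finset.mul_sum, Complex.exp_sum]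
  refine Finset.prod_congr rfl fun i _ => ?_
  have hstep : τ (i + 1) = τ i + u * (1 / (n + 1)) := by
    simp only [hτ]
    push_cast
    ring
  rw [charFun_map_clm (show Measurable (fun ω => Z (τ (i + 1)) ω - Z (τ i) ω) from
      (hm _).sub (hm _)).aemeasurable, hstep,
    (hZ.isLevyProcess.stationary_increments _ _).map_eq, hZ.charFun_eq]
  congr 1
  push_cast
  ring

lemma IsLevyProcessWithTriplet.continuous_levySymbol_adjoint
    (hZ : IsLevyProcessWithTriplet P Z Q b ν) (hL : Continuous L) :
    Continuous fun x : EuclideanSpace ℝ (Fin N) × ℝ =>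
      levySymbol Q b ν ((L x.2).adjoint x.1) :=
  (hZ.isLevyMeasure.continuous_levySymbol Q b).comp
    ((ContinuousLinearMap.adjoint.continuous.comp (hL.comp continuous_snd)).clm_apply
      continuous_fst)

lemma IsLevyProcessWithTriplet.tendsto_charFun_stochRiemannSum [IsProbabilityMeasure P]
    (hZ : IsLevyProcessWithTriplet P Z Q b ν) (hL : Continuous L) (u : ℝ≥0)
    (p : EuclideanSpace ℝ (Fin N)) :
    Tendsto (fun n => charFun (P.map (stochRiemannSum L Z u n)) p) atTop
      (𝓝 (Complex.exp (-((u : ℝ) : ℂ) *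
        ∫ r in (0 : ℝ)..1, levySymbol Q b ν ((L r).adjoint p)))) := by
  simp only [hZ.charFun_stochRiemannSum]
  have hc : Continuous fun r => levySymbol Q b ν ((L r).adjoint p) :=
    (hZ.isLevyMeasure.continuous_levySymbol Q b).comp (continuous_adjoint_apply hL p)
  exact (Complex.continuous_exp.tendsto _).comp ((tendsto_riemann_sum hc).const_mul _)

/-- If `Z` is a Lévy process with symbol `Φ`, there is a Lévy process whose symbol is the average
of `p ↦ Φ ((L r)ᵀ p)` over `r ∈ (0, 1]`. -/
theorem IsLevyProcessWithTriplet.exists_mixed [IsProbabilityMeasure P]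
    (hZ : IsLevyProcessWithTriplet P Z Q b ν) (hL : Continuous L)
    (hinj : ∀ r ∈ Icc (0 : ℝ) 1, Function.Injective (L r)) :
    ∃ P' : Measure (ℝ≥0 → EuclideanSpace ℝ (Fin N)), IsProbabilityMeasure P' ∧
      (∃ Q' b', IsLevyProcessWithTriplet P' (fun u x => x u) Q' b' (mixedMeasure L ν)) ∧
      ∀ (u : ℝ≥0) p, charFun (P'.map fun x => x u) p = Complex.exp (-((u : ℝ) : ℂ) *
        ∫ r in (0 : ℝ)..1, levySymbol Q b ν ((L r).adjoint p)) := by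
  have hm := hZ.isLevyProcess.measurable
  set Ψ : EuclideanSpace ℝ (Fin N) → ℂ := fun p =>
    ∫ r in (0 : ℝ)..1, levySymbol Q b ν ((L r).adjoint p) with hΨ
  have hΨc : Continuous Ψ :=
    intervalIntegral.continuous_parametric_intervalIntegral_of_continuous'
      (hZ.continuous_levySymbol_adjoint hL) 0 1
  have hΨ0 : Ψ 0 = 0 := by simp [hΨ, levySymbol_zero]
  -- The law at time `u` is obtained as a weak limit of Riemann sums over `[0, u]`, so no
  -- Lévy–Khintchine existence theorem is invoked.
  have hμ : ∀ u : ℝ≥0, ∃ μ : Measure (EuclideanSpace ℝ (Fin N)), IsProbabilityMeasure μ ∧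
      ∀ p, charFun μ p = Complex.exp (-((u : ℝ) : ℂ) * Ψ p) := fun u => by
    have hp : ∀ n, IsProbabilityMeasure (P.map (stochRiemannSum L Z u n)) := fun n =>
      Measure.isProbabilityMeasure_map (measurable_stochRiemannSum hm u n).aemeasurable
    exact exists_charFun_eq_of_tendsto (f := fun p => Complex.exp (-((u : ℝ) : ℂ) * Ψ p))
      (by fun_prop) (hZ.tendsto_charFun_stochRiemannSum hL u)
  obtain ⟨P', hP', hlevy, hchar⟩ := exists_isLevyProcess hΨc hΨ0 hμ
  refine ⟨P', hP', ⟨mixedMatrix L Q, (∫ r in (0 : ℝ)..1, L r b) -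
    ∫ x, truncationDefect L x ∂((volume.restrict (Ioc (0 : ℝ) 1)).prod ν), hlevy,
    posSemidef_mixedMatrix hL hZ.posSemidef, hZ.isLevyMeasure.mixedMeasure hL hinj,
    fun u p => ?_⟩, hchar⟩
  rw [hchar, hΨ, ← integral_levySymbol_adjoint hZ.isLevyMeasure hL hinj]

end Riemann

/-! ### Ornstein-Uhlenbeck paths as limits of Riemann sums -/

section Path

variable {N : ℕ}

/-- One-sided limits make the path bounded near every point, and compactness makes this global. -/
lemma IsCadlagPath.isBounded_image {f : ℝ≥0 → EuclideanSpace ℝ (Fin N)} (hf : IsCadlagPath f)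
    {K : Set ℝ≥0} (hK : IsCompact K) : Bornology.IsBounded (f '' K) := by
  refine hK.induction_on (p := fun s => Bornology.IsBounded (f '' s)) (by simp)
    (fun s t hst ht => ht.subset (image_mono hst))
    (fun s t hs ht => by rw [image_union]; exact hs.union ht) fun u _ => ?_
  obtain ⟨hr, l, hl⟩ := hf u
  have key : ∀ {F : Filter ℝ≥0} {y : EuclideanSpace ℝ (Fin N)}, Tendsto f F (𝓝 y) →
      ∀ᶠ v in F, dist (f v) y < 1 := fun h => h (Metric.ball_mem_nhds _ one_pos)
  have h1 : f ⁻¹' Metric.ball l 1 ∪ f ⁻¹' Metric.ball (f u) 1 ∈ 𝓝 u := by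
    rw [← nhdsWithin_univ, ← Iio_union_Ici (a := u), nhdsWithin_union]
    exact union_mem_sup (key hl) (key hr)
  refine ⟨_, mem_nhdsWithin_of_mem_nhds h1,
    ((Metric.isBounded_ball (x := l) (r := 1)).union
      (Metric.isBounded_ball (x := f u) (r := 1))).subset ?_⟩
  rintro _ ⟨v, hv, rfl⟩
  exact hv

/-- The equidistant partition of `[0, t]` into `n + 1` intervals. -/
def partitionPoint (t : ℝ≥0) (n i : ℕ) : ℝ≥0 := t * ((i : ℕ) / (n + 1))

lemma partitionPoint_zero (t : ℝ≥0) (n : ℕ) : partitionPoint t n 0 = 0 := by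
  simp [partitionPoint]

lemma partitionPoint_last (t : ℝ≥0) (n : ℕ) : partitionPoint t n (n + 1) = t := by
  simp [partitionPoint]

lemma monotone_partitionPoint (t : ℝ≥0) (n : ℕ) : Monotone (partitionPoint t n) :=
  fun i j hij => by
    unfold partitionPoint
    gcongr

lemma partitionPoint_succ_sub (t : ℝ≥0) (n i : ℕ) :
    (partitionPoint t n (i + 1) : ℝ) - partitionPoint t n i = t / (n + 1) := by
  simp only [partitionPoint]
  push_cast
  ring

/-- The index of the partition interval that contains `s`. -/
def partitionIndex (t : ℝ≥0) (n : ℕ) (s : ℝ) : ℕ := ⌈s * (n + 1) / t⌉₊ - 1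

lemma partitionIndex_eq {t : ℝ≥0} (ht : 0 < t) {n i : ℕ} {s : ℝ}
    (hs : s ∈ Ioc (partitionPoint t n i : ℝ) (partitionPoint t n (i + 1))) :
    partitionIndex t n s = i := by
  have ht' : (0 : ℝ) < t := ht
  have hn : (0 : ℝ) < n + 1 := by positivity
  -- The cells are open on the left and closed on the right, so the ceiling is the index of the
  -- right endpoint.
  have h : ⌈s * (n + 1) / t⌉₊ = i + 1 := by
    rw [Nat.ceil_eq_iff (by omega)]
    obtain ⟨h1, h2⟩ := hs
    simp only [partitionPoint, NNReal.coe_mul, NNReal.coe_div, NNReal.coe_natCast,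
      NNReal.coe_add, NNReal.coe_one] at h1 h2
    rw [← mul_div_assoc, div_lt_iff₀ hn] at h1
    rw [← mul_div_assoc, le_div_iff₀ hn] at h2
    rw [lt_div_iff₀ ht', div_le_iff₀ ht']
    simp only [Nat.add_sub_cancel]
    constructor <;> linarith
  simp [partitionIndex, h]

lemma mem_Ioc_partitionPoint {t : ℝ≥0} (ht : 0 < t) (n : ℕ) {s : ℝ} (hs : s ∈ Ioc (0 : ℝ) t) :
    partitionIndex t n s < n + 1 ∧
      s ∈ Ioc (partitionPoint t n (partitionIndex t n s) : ℝ)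
        (partitionPoint t n (partitionIndex t n s + 1)) := by
  have ht' : (0 : ℝ) < t := ht
  have hn : (0 : ℝ) < n + 1 := by positivity
  have hpos : 0 < s * (n + 1) / t := div_pos (mul_pos hs.1 hn) ht'
  obtain ⟨k, hk⟩ := Nat.exists_eq_succ_of_ne_zero (Nat.ceil_pos.2 hpos).ne'
  have hi : partitionIndex t n s = k := by simp [partitionIndex, hk]
  obtain ⟨h1, h2⟩ := (Nat.ceil_eq_iff (by omega)).1 hk
  rw [hi]
  rw [lt_div_iff₀ ht'] at h1
  rw [div_le_iff₀ ht'] at h2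
  simp only [Nat.succ_eq_add_one, Nat.add_sub_cancel] at h1 h2
  refine ⟨?_, ?_, ?_⟩
  · have : (k : ℝ) * t < (n + 1) * t := h1.trans_le (by nlinarith [hs.2])
    exact_mod_cast lt_of_mul_lt_mul_right this ht'.le
  · simp only [partitionPoint, NNReal.coe_mul, NNReal.coe_div, NNReal.coe_natCast,
      NNReal.coe_add, NNReal.coe_one]
    rw [← mul_div_assoc, div_lt_iff₀ hn]
    linarith
  · simp only [partitionPoint, NNReal.coe_mul, NNReal.coe_div, NNReal.coe_natCast,
      NNReal.coe_add, NNReal.coe_one]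
    rw [← mul_div_assoc, le_div_iff₀ hn]
    linarith

lemma tendsto_partitionPoint {t : ℝ≥0} (ht : 0 < t) {s : ℝ} (hs : s ∈ Ioc (0 : ℝ) t) :
    Tendsto (fun n => (partitionPoint t n (partitionIndex t n s) : ℝ)) atTop (𝓝 s) ∧
      Tendsto (fun n => (partitionPoint t n (partitionIndex t n s + 1) : ℝ)) atTop (𝓝 s) := by
  have hmesh : Tendsto (fun n : ℕ => (t : ℝ) / (n + 1)) atTop (𝓝 0) :=
    tendsto_const_nhds.div_atTop (tendsto_natCast_atTop_atTop.atTop_add tendsto_const_nhds)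
  have h := fun n => (mem_Ioc_partitionPoint ht n hs).2
  have hd := fun n => partitionPoint_succ_sub t n (partitionIndex t n s)
  constructor
  · refine tendsto_of_tendsto_of_tendsto_of_le_of_le (g := fun n : ℕ => s - (t : ℝ) / (n + 1))
      (h := fun _ => s) (by simpa using hmesh.const_sub s) tendsto_const_nhds
      (fun n => ?_) fun n => (h n).1.le
    have := hd n
    have := (h n).2
    dsimp only
    linarith
  · refine tendsto_of_tendsto_of_tendsto_of_le_of_le (h := fun n : ℕ => s + (t : ℝ) / (n + 1))
      (g := fun _ => s) tendsto_const_nhds (by simpa using hmesh.const_add s)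
      (fun n => (h n).2) fun n => ?_
    have := hd n
    have := (h n).1
    dsimp only
    linarith

/-- Let `f` be a càdlàg solution of `f t = x + ∫₀ᵗ a (f s) ds + z t` with `z 0 = 0`, and let `G`
solve `G' = -G a`. Then the Riemann sums of `∫₀ᵗ G dz` converge to `G t (f t) - G 0 x`. -/
theorem IsCadlagPath.tendsto_sum_increments {f z : ℝ≥0 → EuclideanSpace ℝ (Fin N)}
    {x : EuclideanSpace ℝ (Fin N)} {a : EuclideanSpace ℝ (Fin N) →L[ℝ] EuclideanSpace ℝ (Fin N)}
    {G : ℝ → EuclideanSpace ℝ (Fin N) →L[ℝ] EuclideanSpace ℝ (Fin N)}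
    (hf : IsCadlagPath f)
    (hint : ∀ u : ℝ≥0, IntervalIntegrable (fun s : ℝ => a (f s.toNNReal)) volume 0 u)
    (heq : ∀ u : ℝ≥0, f u = x + (∫ s in (0 : ℝ)..u, a (f s.toNNReal)) + z u)
    (hz : z 0 = 0) (hG : ∀ s, HasDerivAt G (-(G s ∘L a)) s) {t : ℝ≥0} (ht : 0 < t) :
    Tendsto (fun n : ℕ => ∑ i ∈ Finset.range (n + 1), G (partitionPoint t n i)
      (z (partitionPoint t n (i + 1)) - z (partitionPoint t n i))) atTop
      (𝓝 (G t (f t) - G 0 x)) := by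
  have hGc : Continuous G := continuous_iff_continuousAt.2 fun s => (hG s).continuousAt
  have hf0 : f 0 = x := by simpa [hz] using heq 0
  have hint' : ∀ u v : ℝ≥0, IntervalIntegrable (fun s : ℝ => a (f s.toNNReal)) volume u v :=
    fun u v => (hint u).symm.trans (hint v)
  set τ := partitionPoint t with hτ
  -- Integrand of the error in the summation by parts: its first term integrates to `(G (τ i) - G (τ
  -- (i+1))) (f (τ (i+1)))`, its second to `G (τ i)` applied to the drift over the cell.
  let D : ℕ → ℕ → ℝ → EuclideanSpace ℝ (Fin N) := fun n i s =>
    G s (a (f (τ n (i + 1)))) - G (τ n i) (a (f s.toNNReal))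
  let H : ℕ → ℝ → EuclideanSpace ℝ (Fin N) := fun n s => D n (partitionIndex t n s) s
  have hD1 : ∀ n i, IntervalIntegrable (fun s => G s (a (f (τ n (i + 1))))) volume
      (τ n i) (τ n (i + 1)) := fun n i =>
    (hGc.clm_apply continuous_const).intervalIntegrable _ _
  have hD2 : ∀ n i, IntervalIntegrable (fun s : ℝ => G (τ n i) (a (f s.toNNReal))) volume
      (τ n i) (τ n (i + 1)) := fun n i =>
    ⟨(G (τ n i)).integrable_comp (hint' _ _).1, (G (τ n i)).integrable_comp (hint' _ _).2⟩
  have hDH : ∀ n i, EqOn (D n i) (H n) (Ioc (τ n i : ℝ) (τ n (i + 1))) := fun n i s hs => by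
    simp only [H, partitionIndex_eq ht hs]
  have hle : ∀ n i, (τ n i : ℝ) ≤ τ n (i + 1) := fun n i =>
    NNReal.coe_le_coe.2 (monotone_partitionPoint t n (Nat.le_succ i))
  have hHint : ∀ n i, IntervalIntegrable (H n) volume (τ n i) (τ n (i + 1)) := fun n i =>
    ((hD1 n i).sub (hD2 n i)).congr (by rw [uIoc_of_le (hle n i)]; exact hDH n i)
  have hterm : ∀ n i, G (τ n i) (z (τ n (i + 1)) - z (τ n i)) =
      (G (τ n (i + 1)) (f (τ n (i + 1))) - G (τ n i) (f (τ n i))) +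
        ∫ s in (τ n i : ℝ)..τ n (i + 1), H n s := fun n i => by
    have h1 : z (τ n (i + 1)) - z (τ n i) = f (τ n (i + 1)) - f (τ n i) -
        ∫ s in (τ n i : ℝ)..τ n (i + 1), a (f s.toNNReal) := by
      rw [← intervalIntegral.integral_interval_sub_left (hint (τ n (i + 1))) (hint (τ n i)),
        heq (τ n (i + 1)), heq (τ n i)]
      abel
    have h2 : ∫ s in (τ n i : ℝ)..τ n (i + 1), G s (a (f (τ n (i + 1)))) =
        G (τ n i) (f (τ n (i + 1))) - G (τ n (i + 1)) (f (τ n (i + 1))) := by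
      have hder : ∀ s : ℝ, HasDerivAt (fun s => -(G s (f (τ n (i + 1)))))
          (G s (a (f (τ n (i + 1))))) s := fun s => by
        have := ((hG s).clm_apply (hasDerivAt_const s (f (τ n (i + 1))))).neg
        simp only [neg_apply, ContinuousLinearMap.comp_apply, map_zero,
          add_zero, neg_neg] at this
        exact this
      rw [intervalIntegral.integral_eq_sub_of_hasDerivAt (fun s _ => hder s) (hD1 n i)]
      abel
    have h3 : ∫ s in (τ n i : ℝ)..τ n (i + 1), G (τ n i) (a (f s.toNNReal)) =
        G (τ n i) (∫ s in (τ n i : ℝ)..τ n (i + 1), a (f s.toNNReal)) :=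
      ContinuousLinearMap.intervalIntegral_comp_comm _ (hint' _ _)
    have h4 : ∫ s in (τ n i : ℝ)..τ n (i + 1), H n s =
        ∫ s in (τ n i : ℝ)..τ n (i + 1), D n i s := by
      refine intervalIntegral.integral_congr_ae (Eventually.of_forall fun s hs => ?_)
      rw [uIoc_of_le (hle n i)] at hs
      exact (hDH n i hs).symm
    rw [h4, intervalIntegral.integral_sub (hD1 n i) (hD2 n i), h2, h3, h1]
    simp only [map_sub]
    abel
  -- The boundary terms telescope; it remains to show that the integral of `H n` tends to `0`, by
  -- dominated convergence.
  have hsum : ∀ n : ℕ, ∑ i ∈ Finset.range (n + 1), G (τ n i) (z (τ n (i + 1)) - z (τ n i)) =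
      G t (f t) - G 0 x + ∫ s in (0 : ℝ)..t, H n s := fun n => by
    simp only [hterm]
    rw [Finset.sum_add_distrib, Finset.sum_range_sub fun i => G (τ n i) (f (τ n i)),
      intervalIntegral.sum_integral_adjacent_intervals (a := fun i => (τ n i : ℝ))
        fun i _ => hHint n i]
    simp only [hτ, partitionPoint_zero, partitionPoint_last, NNReal.coe_zero, hf0]
  have ht0 : (0 : ℝ) ≤ t := t.2
  obtain ⟨C, hC⟩ := isBounded_iff_forall_norm_le.1
    (hf.isBounded_image (isCompact_Icc (a := 0) (b := t)))
  obtain ⟨K, hK⟩ := (isCompact_Icc (a := (0 : ℝ)) (b := t)).exists_bound_of_continuousOn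
    hGc.continuousOn
  have hC' : ∀ u ≤ t, ‖f u‖ ≤ C := fun u hu => hC _ ⟨u, ⟨zero_le, hu⟩, rfl⟩
  have hK0 : 0 ≤ K := (norm_nonneg _).trans (hK 0 ⟨le_rfl, ht0⟩)
  have hbd : ∀ s ∈ Icc (0 : ℝ) t, ∀ u ≤ t, ‖G s (a (f u))‖ ≤ K * (‖a‖ * C) := fun s hs u hu =>
    ((G s).le_opNorm _).trans (mul_le_mul (hK s hs) (((a).le_opNorm _).trans
      (mul_le_mul_of_nonneg_left (hC' u hu) (norm_nonneg _))) (norm_nonneg _) hK0)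
  have hlast : ∀ n i, i < n + 1 → τ n (i + 1) ≤ t := fun n i hi =>
    (monotone_partitionPoint t n (by omega)).trans_eq (partitionPoint_last t n)
  have hlim : Tendsto (fun n => ∫ s in (0 : ℝ)..t, H n s) atTop
      (𝓝 (∫ s in (0 : ℝ)..t, (0 : EuclideanSpace ℝ (Fin N)))) := by
    refine intervalIntegral.tendsto_integral_filter_of_dominated_convergence
      (fun _ => K * (‖a‖ * C) + K * (‖a‖ * C)) (Eventually.of_forall fun n => ?_)
      (Eventually.of_forall fun n => Eventually.of_forall fun s hs => ?_) (by simp)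
      (Eventually.of_forall fun s hs => ?_)
    · have := IntervalIntegrable.trans_iterate (a := fun i => (τ n i : ℝ)) (n := n + 1)
        fun i _ => hHint n i
      simp only [hτ, partitionPoint_zero, partitionPoint_last, NNReal.coe_zero] at this
      rw [uIoc_of_le ht0]
      exact this.1.aestronglyMeasurable
    · rw [uIoc_of_le ht0] at hs
      obtain ⟨h1, h2⟩ := mem_Ioc_partitionPoint ht n hs
      have h3 := hlast n _ h1
      refine (norm_sub_le _ _).trans (add_le_add (hbd s ⟨hs.1.le, hs.2⟩ _ h3)
        (hbd _ ⟨NNReal.coe_nonneg _, h2.1.le.trans hs.2⟩ _ (Real.toNNReal_le_iff_le_coe.2 hs.2)))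
    · rw [uIoc_of_le ht0] at hs
      obtain ⟨h1, h2⟩ := tendsto_partitionPoint ht hs
      -- In `D` the path is sampled at the right endpoint of the cell, which tends to `s` from the
      -- right, so right-continuity suffices.
      have hr : Tendsto (fun n => τ n (partitionIndex t n s + 1)) atTop
          (𝓝[≥] s.toNNReal) := by
        refine tendsto_nhdsWithin_iff.2 ⟨?_, Eventually.of_forall fun n => ?_⟩
        · have := (continuous_real_toNNReal.tendsto s).comp h2
          simpa only [Function.comp_def, Real.toNNReal_coe] using this
        · exact Real.toNNReal_le_iff_le_coe.2 (mem_Ioc_partitionPoint ht n hs).2.2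
      have h3 : Tendsto (fun n => G s (a (f (τ n (partitionIndex t n s + 1))))) atTop
          (𝓝 (G s (a (f s.toNNReal)))) :=
        (((G s).continuous.comp a.continuous).tendsto _).comp ((hf s.toNNReal).1.tendsto.comp hr)
      have h4 : Tendsto (fun n => G (τ n (partitionIndex t n s)) (a (f s.toNNReal))) atTop
          (𝓝 (G s (a (f s.toNNReal)))) :=
        ((hGc.clm_apply continuous_const).tendsto s).comp h1
      simpa using h3.sub h4
  simp only [hsum]
  simpa using hlim.const_add (G t (f t) - G 0 x)

end Path

/-! ### The Kalman filtration -/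

section Kalman

variable {N d : ℕ} {A : Matrix (Fin N) (Fin N) ℝ} {B : Matrix (Fin N) (Fin d) ℝ}

lemma toEuclideanLin_mem_kalmanSpace {k h : ℕ} (hk : k < h) (v : EuclideanSpace ℝ (Fin d)) :
    Matrix.toEuclideanLin (A ^ k * B) v ∈ kalmanSpace A B h :=
  le_iSup₂_of_le (f := fun k (_ : k ∈ Finset.range h) =>
    LinearMap.range (Matrix.toEuclideanLin (A ^ k * B))) k (Finset.mem_range.2 hk) le_rfl ⟨v, rfl⟩

lemma monotone_kalmanSpace : Monotone (kalmanSpace A B) := fun _ _ hrs =>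
  iSup₂_le fun k hk => by
    rintro _ ⟨v, rfl⟩
    exact toEuclideanLin_mem_kalmanSpace ((Finset.mem_range.1 hk).trans_le hrs) v

lemma kalmanSpace_zero : kalmanSpace A B 0 = ⊥ := by simp [kalmanSpace]

lemma kalmanSpace_eq_top {r : ℕ} (h : (kalmanMatrix A B r).rank = N) : kalmanSpace A B r = ⊤ := by
  have hrange : LinearMap.range (kalmanMatrix A B r).mulVecLin = ⊤ :=
    Submodule.eq_top_of_finrank_eq (by
      have : Module.finrank ℝ (LinearMap.range (kalmanMatrix A B r).mulVecLin) = N := h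
      simpa using this)
  refine eq_top_iff.2 fun w _ => ?_
  obtain ⟨v, hv⟩ := LinearMap.range_eq_top.1 hrange w.ofLp
  have hw : w = ∑ k : Fin r, Matrix.toEuclideanLin (A ^ (k : ℕ) * B)
      (WithLp.toLp 2 fun j => v (k, j)) := by
    ext i
    rw [← congrFun hv i]
    simp only [WithLp.ofLp_sum, Finset.sum_apply, Matrix.toLpLin_apply, Matrix.mulVecLin_apply,
      Matrix.mulVec, dotProduct, Fintype.sum_prod_type, kalmanMatrix, Matrix.of_apply]
  rw [hw]
  exact Submodule.sum_mem _ fun k _ => toEuclideanLin_mem_kalmanSpace k.2 _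

lemma kalmanSpace_kalmanIndex (hK : KalmanCondition A B) :
    kalmanSpace A B (kalmanIndex A B) = ⊤ := by
  refine kalmanSpace_eq_top (Nat.sInf_mem (s := {r | 1 ≤ r ∧ (kalmanMatrix A B r).rank = N}) ?_).2
  -- For `N = 0` the choice `r = N` violates `1 ≤ r`, and `r = 1` is taken instead.
  rcases Nat.eq_zero_or_pos N with rfl | hN
  · exact ⟨1, le_rfl, Nat.le_zero.1 (by simpa using (kalmanMatrix A B 1).rank_le_card_height)⟩
  · exact ⟨N, hN, hK⟩

/-- Layers of different index are orthogonal: the lower one lies in a `V_j` to which the higher one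
is orthogonal. -/
lemma layerProjection_layerProjection (i h : ℕ) (v : EuclideanSpace ℝ (Fin N)) :
    layerProjection A B i (layerProjection A B h v) =
      if i = h then layerProjection A B h v else 0 := by
  have hmem := Submodule.starProjection_apply_mem
    ((kalmanSpace A B h)ᗮ ⊓ kalmanSpace A B (h + 1)) v
  split_ifs with hih
  · subst hih
    exact Submodule.starProjection_eq_self_iff.2 hmem
  · refine (Submodule.starProjection_apply_eq_zero_iff _).2
      ((Submodule.mem_orthogonal _ _).2 fun w hw => ?_)
    rcases lt_or_gt_of_ne hih with hlt | hlt
    · exact (Submodule.mem_orthogonal _ _).1 hmem.1 w (monotone_kalmanSpace hlt hw.2)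
    · exact (Submodule.mem_orthogonal' _ _).1 hw.1 _ (monotone_kalmanSpace hlt hmem.2)

lemma layerProjection_scalingMap {i : ℕ} (hi : i < kalmanIndex A B) (t : ℝ)
    (v : EuclideanSpace ℝ (Fin N)) :
    layerProjection A B i (scalingMap A B t v) = t ^ i • layerProjection A B i v := by
  simp only [scalingMap, sum_apply, smul_apply, map_sum, map_smul,
    layerProjection_layerProjection, smul_ite, smul_zero]
  rw [Finset.sum_ite_eq, if_pos (Finset.mem_range.2 hi)]

/-- If `M_t v = 0`, every layer component of `v` vanishes because `t ^ i ≠ 0`. Inductively `v ⊥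
V_h`: a vector of `V_{h+1}` splits into a part in `V_h` and a part in the next layer. At the Kalman
index `V_h` is the whole space. -/
lemma scalingMap_injective (hK : KalmanCondition A B) {t : ℝ} (ht : 0 < t) :
    Function.Injective (scalingMap A B t) := by
  refine (injective_iff_map_eq_zero _).2 fun v hv => ?_
  have hlayer : ∀ i < kalmanIndex A B, layerProjection A B i v = 0 := fun i hi => by
    have := layerProjection_scalingMap hi t v
    rw [hv, map_zero] at this
    exact (smul_eq_zero.1 this.symm).resolve_left (pow_pos ht i).ne'
  have hperp : ∀ h ≤ kalmanIndex A B, v ∈ (kalmanSpace A B h)ᗮ := by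
    intro h
    induction h with
    | zero => simp [kalmanSpace_zero]
    | succ h ih =>
      intro hh
      have h1 := ih (Nat.le_of_succ_le hh)
      have h2 := (Submodule.starProjection_apply_eq_zero_iff _).1 (hlayer h hh)
      refine (Submodule.mem_orthogonal _ _).2 fun w hw => ?_
      have hPw := Submodule.starProjection_apply_mem (kalmanSpace A B h) w
      rw [← sub_add_cancel w ((kalmanSpace A B h).starProjection w), inner_add_left,
        (Submodule.mem_orthogonal _ _).1 h1 _ hPw, add_zero]
      exact (Submodule.mem_orthogonal _ _).1 h2 _
        ⟨Submodule.sub_starProjection_mem_orthogonal w,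
          Submodule.sub_mem _ hw (monotone_kalmanSpace (Nat.le_succ h) hPw)⟩
  simpa [kalmanSpace_kalmanIndex hK] using hperp _ le_rfl

lemma toEuclideanLin_injective (hB : B.rank = d) :
    Function.Injective (Matrix.toEuclideanLin B) := by
  have hker : LinearMap.ker B.mulVecLin = ⊥ := by
    have h := B.mulVecLin.finrank_range_add_finrank_ker
    have h' : Module.finrank ℝ (LinearMap.range B.mulVecLin) = d := hB
    rw [h', Module.finrank_fin_fun] at h
    exact Submodule.finrank_eq_zero.1 (by omega)
  intro v w hvw
  have h : B.mulVecLin v.ofLp = B.mulVecLin w.ofLp := congrArg WithLp.ofLp hvw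
  exact WithLp.ofLp_injective 2 (LinearMap.ker_eq_bot.1 hker h)

lemma toEuclideanLin_pow_mul (k : ℕ) (v : EuclideanSpace ℝ (Fin d)) :
    Matrix.toEuclideanLin (A ^ k * B) v =
      (Matrix.toEuclideanCLM (𝕜 := ℝ) A ^ k) (Matrix.toEuclideanLin B v) := by
  rw [← map_pow]
  change WithLp.toLp 2 ((A ^ k * B).mulVec v.ofLp) =
    WithLp.toLp 2 ((A ^ k).mulVec (B.mulVec v.ofLp))
  rw [Matrix.mulVec_mulVec]

lemma toEuclideanLin_exp (C : Matrix (Fin N) (Fin N) ℝ) (x : EuclideanSpace ℝ (Fin N)) :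
    Matrix.toEuclideanLin (NormedSpace.exp C) x =
      NormedSpace.exp (Matrix.toEuclideanCLM (𝕜 := ℝ) C) x := by
  have h : Matrix.toEuclideanCLM (𝕜 := ℝ) (NormedSpace.exp C) =
      NormedSpace.exp (Matrix.toEuclideanCLM (𝕜 := ℝ) C) := by
    open scoped Matrix.Norms.L2Operator in
    let _ : NormedAlgebra ℚ (Matrix (Fin N) (Fin N) ℝ) := NormedAlgebra.restrictScalars ℚ ℝ _
    let _ : Algebra ℚ (EuclideanSpace ℝ (Fin N) →L[ℝ] EuclideanSpace ℝ (Fin N)) :=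
      Algebra.restrictScalars ℚ ℝ _
    exact NormedSpace.map_exp (Matrix.toEuclideanCLM (n := Fin N) (𝕜 := ℝ))
      (LinearMap.continuous_of_finiteDimensional
        (Matrix.toEuclideanCLM (n := Fin N) (𝕜 := ℝ)).toAlgEquiv.toLinearMap) C
  rw [← h]
  rfl

/-! ### Exponentials of bounded operators -/

section Exp

variable {E : Type*} [NormedAddCommGroup E] [InnerProductSpace ℝ E]

lemma exp_zero_smul_apply (a : E →L[ℝ] E) (v : E) :
    NormedSpace.exp ((0 : ℝ) • a) v = v := by
  simp

variable [CompleteSpace E]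

lemma exp_neg_apply_exp_apply (a : E →L[ℝ] E) (v : E) :
    NormedSpace.exp (-a) (NormedSpace.exp a v) = v := by
  let _ : NormedAlgebra ℚ (E →L[ℝ] E) := NormedAlgebra.restrictScalars ℚ ℝ _
  have h := NormedSpace.exp_add_of_commute ((Commute.refl a).neg_left)
  rw [neg_add_cancel, NormedSpace.exp_zero] at h
  exact (DFunLike.congr_fun h v).symm

lemma exp_apply_injective (a : E →L[ℝ] E) : Function.Injective ⇑(NormedSpace.exp a : E →L[ℝ] E) :=
  Function.LeftInverse.injective (exp_neg_apply_exp_apply a)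

lemma hasDerivAt_exp_sub_smul (a : E →L[ℝ] E) (t s : ℝ) :
    HasDerivAt (fun s => NormedSpace.exp ((t - s) • a)) (-(NormedSpace.exp ((t - s) • a) ∘L a))
      s := by
  have h := (hasDerivAt_exp_smul_const (𝕂 := ℝ) a (t - s)).scomp s
    ((hasDerivAt_id s).const_sub t)
  simpa [Function.comp_def, ContinuousLinearMap.mul_def] using h

/-- A function vanishing on an open interval has zero derivative there, and differentiating `e^{sa}`
brings down one more factor `a`. -/
lemma inner_exp_pow_eq_zero (a : E →L[ℝ] E) {q w : E} {t : ℝ}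
    (h : ∀ s ∈ Ioo 0 t, inner ℝ q (NormedSpace.exp (s • a) w) = 0) (k : ℕ) :
    ∀ s ∈ Ioo 0 t, inner ℝ q (NormedSpace.exp (s • a) ((a ^ k) w)) = 0 := by
  induction k with
  | zero => simpa using h
  | succ k ih =>
    intro s hs
    have hd : HasDerivAt (fun s => inner ℝ q (NormedSpace.exp (s • a) ((a ^ k) w)))
        (inner ℝ q (NormedSpace.exp (s • a) ((a ^ (k + 1)) w))) s := by
      have h1 := (hasDerivAt_exp_smul_const (𝕂 := ℝ) a s).clm_apply
        (hasDerivAt_const s ((a ^ k) w))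
      have h2 := (hasDerivAt_const s q).inner ℝ h1
      simpa [pow_succ', mul_apply_eq_comp] using h2
    have h0 : (fun s => inner ℝ q (NormedSpace.exp (s • a) ((a ^ k) w))) =ᶠ[𝓝 s] fun _ => 0 := by
      filter_upwards [isOpen_Ioo.mem_nhds hs] with u hu using ih u hu
    exact hd.unique ((hasDerivAt_const s (0 : ℝ)).congr_of_eventuallyEq h0)

end Exp

/-- The classical duality with observability: at one interior time `q` is orthogonal to every
`e^{sa} a^k B v`. These vectors span, since the `a^k B v` do by the Kalman condition and the
exponential is invertible. -/
lemma eq_zero_of_inner_exp_eq_zero (hK : KalmanCondition A B) {q : EuclideanSpace ℝ (Fin N)}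
    {t : ℝ} (ht : 0 < t)
    (h : ∀ s ∈ Ioo 0 t, ∀ v, inner ℝ q (NormedSpace.exp (s • Matrix.toEuclideanCLM (𝕜 := ℝ) A)
      (Matrix.toEuclideanLin B v)) = 0) : q = 0 := by
  set a := Matrix.toEuclideanCLM (𝕜 := ℝ) A with ha
  have hs : t / 2 ∈ Ioo 0 t := ⟨by linarith, by linarith⟩
  have hle : kalmanSpace A B N ≤
      LinearMap.ker (innerSL ℝ q ∘L NormedSpace.exp ((t / 2) • a) :
        EuclideanSpace ℝ (Fin N) →L[ℝ] ℝ).toLinearMap := by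
    refine iSup₂_le fun k _ => ?_
    rintro _ ⟨v, rfl⟩
    have := inner_exp_pow_eq_zero a (fun s hs => h s hs v) k _ hs
    rw [← toEuclideanLin_pow_mul] at this
    simpa using this
  rw [kalmanSpace_eq_top hK] at hle
  -- The test vector is chosen so that the exponential maps it to `q`, which gives `⟨q, q⟩ = 0`.
  have h1 : inner ℝ q (NormedSpace.exp ((t / 2) • a) (NormedSpace.exp (-((t / 2) • a)) q)) = 0 := by
    simpa using hle (Submodule.mem_top (x := NormedSpace.exp (-((t / 2) • a)) q))
  have h2 := exp_neg_apply_exp_apply (-((t / 2) • a)) q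
  rw [neg_neg] at h2
  rw [h2] at h1
  exact inner_self_eq_zero.1 h1

end Kalman

/-! ### The marginal laws of the Ornstein–Uhlenbeck process -/

lemma tendsto_charFun_of_ae_tendsto {E Ω : Type*} [NormedAddCommGroup E] [InnerProductSpace ℝ E]
    [MeasurableSpace E] [BorelSpace E] [SecondCountableTopology E] [MeasurableSpace Ω]
    {P : Measure Ω} [IsFiniteMeasure P] {Y : ℕ → Ω → E} {Y' : Ω → E}
    (hY : ∀ n, Measurable (Y n)) (hY' : Measurable Y')
    (h : ∀ᵐ ω ∂P, Tendsto (fun n => Y n ω) atTop (𝓝 (Y' ω))) (p : E) :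
    Tendsto (fun n => charFun (P.map (Y n)) p) atTop (𝓝 (charFun (P.map Y') p)) := by
  simp only [charFun_apply]
  rw [integral_map hY'.aemeasurable (by fun_prop)]
  have h1 : ∀ n, ∫ x, Complex.exp ((inner ℝ x p : ℝ) * Complex.I) ∂(P.map (Y n)) =
      ∫ ω, Complex.exp ((inner ℝ (Y n ω) p : ℝ) * Complex.I) ∂P := fun n =>
    integral_map (hY n).aemeasurable (by fun_prop)
  simp only [h1]
  refine tendsto_integral_of_dominated_convergence (fun _ => 1) (fun n => ?_)
    (integrable_const _) (fun n => Eventually.of_forall fun ω => ?_) ?_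
  · have := hY n
    fun_prop
  · rw [Complex.norm_exp_ofReal_mul_I]
  · filter_upwards [h] with ω hω
    exact ((by fun_prop : Continuous fun x : E =>
      Complex.exp ((inner ℝ x p : ℝ) * Complex.I)).tendsto _).comp hω

section Kernel

variable {N d : ℕ} {A : Matrix (Fin N) (Fin N) ℝ} {B : Matrix (Fin N) (Fin d) ℝ}

/-- The integrand `r ↦ T e^{t (1 - r) A} B` of the stochastic integral that represents `T X_t`. -/
def ouKernel (A : Matrix (Fin N) (Fin N) ℝ) (B : Matrix (Fin N) (Fin d) ℝ) (t : ℝ)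
    (T : EuclideanSpace ℝ (Fin N) →L[ℝ] EuclideanSpace ℝ (Fin N)) (r : ℝ) :
    EuclideanSpace ℝ (Fin d) →L[ℝ] EuclideanSpace ℝ (Fin N) :=
  T ∘L NormedSpace.exp ((t - t * r) • Matrix.toEuclideanCLM (𝕜 := ℝ) A) ∘L
    (Matrix.toEuclideanLin B).toContinuousLinearMap

lemma continuous_ouKernel (t : ℝ)
    (T : EuclideanSpace ℝ (Fin N) →L[ℝ] EuclideanSpace ℝ (Fin N)) :
    Continuous (ouKernel A B t T) := by
  have h : Continuous fun r => NormedSpace.exp ((t - t * r) •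
      (Matrix.toEuclideanCLM (𝕜 := ℝ) A : EuclideanSpace ℝ (Fin N) →L[ℝ] _)) :=
    (continuous_iff_continuousAt.2 fun s =>
      (hasDerivAt_exp_sub_smul (Matrix.toEuclideanCLM (𝕜 := ℝ) A) t s).continuousAt).comp
        (continuous_const_mul t)
  exact continuous_const.clm_comp (h.clm_comp continuous_const)

lemma ouKernel_injective (hB : B.rank = d) (t : ℝ)
    {T : EuclideanSpace ℝ (Fin N) →L[ℝ] EuclideanSpace ℝ (Fin N)} (hT : Function.Injective T)
    (r : ℝ) : Function.Injective (ouKernel A B t T r) :=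
  hT.comp ((exp_apply_injective _).comp (toEuclideanLin_injective hB))

lemma eq_zero_of_adjoint_ouKernel (hK : KalmanCondition A B) {t : ℝ} (ht : 0 < t)
    {T : EuclideanSpace ℝ (Fin N) →L[ℝ] EuclideanSpace ℝ (Fin N)} (hT : Function.Surjective T)
    {p : EuclideanSpace ℝ (Fin N)}
    (hp : ∀ r ∈ Icc (0 : ℝ) 1, (ouKernel A B t T r).adjoint p = 0) : p = 0 := by
  have hq : T.adjoint p = 0 := by
    refine eq_zero_of_inner_exp_eq_zero hK ht fun s hs v => ?_
    -- The kernel runs time backwards on the unit interval: `r = 1 - s / t` corresponds to the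
    -- exponential at `s`.
    have h := hp (1 - s / t) ⟨by linarith [(div_le_one ht).2 hs.2.le], by
      linarith [div_nonneg hs.1.le ht.le]⟩
    have hs' : t - t * (1 - s / t) = s := by field_simp; ring
    have h2 : inner ℝ ((ouKernel A B t T (1 - s / t)).adjoint p) v = 0 := by
      rw [h, inner_zero_left]
    rw [ContinuousLinearMap.adjoint_inner_left, ouKernel, hs'] at h2
    rw [ContinuousLinearMap.adjoint_inner_left]
    exact h2
  obtain ⟨w, hw⟩ := hT p
  have h : inner ℝ (T.adjoint p) w = 0 := by rw [hq, inner_zero_left]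
  rw [ContinuousLinearMap.adjoint_inner_left, hw] at h
  exact inner_self_eq_zero.1 h

variable {Ω : Type*} [MeasurableSpace Ω] {P : Measure Ω}
  {Z : ℝ≥0 → Ω → EuclideanSpace ℝ (Fin d)} {x : EuclideanSpace ℝ (Fin N)}
  {X : ℝ≥0 → Ω → EuclideanSpace ℝ (Fin N)}

/-- The pathwise limit theorem with `G s = e^{(t-s)A}`, for which `G t` is the identity; `M` cancels
the factor `T` of the kernel. -/
lemma IsOUProcess.ae_tendsto_stochRiemannSum (hX : IsOUProcess P A B Z x X)
    (hZ : ∀ᵐ ω ∂P, Z 0 ω = 0) {t : ℝ≥0} (ht : 0 < t)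
    {M T : EuclideanSpace ℝ (Fin N) →L[ℝ] EuclideanSpace ℝ (Fin N)} (hMT : ∀ v, M (T v) = v) :
    ∀ᵐ ω ∂P, Tendsto (fun n => M (stochRiemannSum (ouKernel A B t T) Z t n ω)) atTop
      (𝓝 (X t ω - Matrix.toEuclideanLin (NormedSpace.exp ((t : ℝ) • A)) x)) := by
  filter_upwards [hX.cadlag, hX.integrable, hX.equation, hZ] with ω hcad hint heq h0
  have h := hcad.tendsto_sum_increments (z := fun u => Matrix.toEuclideanLin B (Z u ω))
    (a := Matrix.toEuclideanCLM (𝕜 := ℝ) A) hint heq (by simp [h0])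
    (hasDerivAt_exp_sub_smul _ (t : ℝ)) ht
  have hlim : NormedSpace.exp (((t : ℝ) - t) • Matrix.toEuclideanCLM (𝕜 := ℝ) A) (X t ω) -
      NormedSpace.exp (((t : ℝ) - 0) • Matrix.toEuclideanCLM (𝕜 := ℝ) A) x =
      X t ω - Matrix.toEuclideanLin (NormedSpace.exp ((t : ℝ) • A)) x := by
    rw [toEuclideanLin_exp, map_smul, sub_zero, sub_self, exp_zero_smul_apply]
  rw [hlim] at h
  refine h.congr fun n => ?_
  rw [stochRiemannSum, map_sum]
  refine Finset.sum_congr rfl fun i _ => ?_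
  have hτ : ((partitionPoint t n i : ℝ≥0) : ℝ) = t * (i / (n + 1)) := by
    simp [partitionPoint]
  rw [ouKernel, ContinuousLinearMap.comp_apply, hMT, hτ, ← map_sub]
  rfl

/-- The one-dimensional marginals of the Ornstein-Uhlenbeck process. -/
lemma IsOUProcess.identDistrib [IsProbabilityMeasure P] {Q : Matrix (Fin d) (Fin d) ℝ}
    {b : EuclideanSpace ℝ (Fin d)} {ν : Measure (EuclideanSpace ℝ (Fin d))}
    (hX : IsOUProcess P A B Z x X) (hZ : IsLevyProcessWithTriplet P Z Q b ν)
    {t : ℝ≥0} (ht : 0 < t)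
    {M T : EuclideanSpace ℝ (Fin N) →L[ℝ] EuclideanSpace ℝ (Fin N)} (hMT : ∀ v, M (T v) = v)
    {Ω' : Type*} [MeasurableSpace Ω'] {P' : Measure Ω'} [IsProbabilityMeasure P']
    {S : Ω' → EuclideanSpace ℝ (Fin N)} (hS : Measurable S)
    (hchar : ∀ p, charFun (P'.map S) p = Complex.exp (-((t : ℝ) : ℂ) *
      ∫ r in (0 : ℝ)..1, levySymbol Q b ν ((ouKernel A B t T r).adjoint p))) :
    IdentDistrib (X t) (fun ω' => Matrix.toEuclideanLin (NormedSpace.exp ((t : ℝ) • A)) x +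
      M (S ω')) P P' := by
  set y := Matrix.toEuclideanLin (NormedSpace.exp ((t : ℝ) • A)) x with hy
  have hR := measurable_stochRiemannSum (L := ouKernel A B t T) hZ.isLevyProcess.measurable t
  have hY : Measurable fun ω => X t ω - y := (hX.measurable t).sub_const y
  have hMS : Measurable fun ω' => M (S ω') := M.measurable.comp hS
  have hmap : P.map (fun ω => X t ω - y) = P'.map fun ω' => M (S ω') := by
    have := Measure.isProbabilityMeasure_map (μ := P) hY.aemeasurable
    have := Measure.isProbabilityMeasure_map (μ := P') hMS.aemeasurable
    refine Measure.ext_of_charFun (funext fun p => ?_)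
    -- The characteristic functions of the same Riemann sums have two limits: one from almost sure
    -- convergence, the other from the explicit formula.
    refine tendsto_nhds_unique (tendsto_charFun_of_ae_tendsto
      (Y := fun n ω => M (stochRiemannSum (ouKernel A B t T) Z t n ω))
      (fun n => M.measurable.comp (hR n)) hY
      (hX.ae_tendsto_stochRiemannSum hZ.isLevyProcess.zero ht hMT) p) ?_
    rw [charFun_map_clm hS.aemeasurable, hchar]
    simp only [charFun_map_clm (hR _).aemeasurable]
    exact hZ.tendsto_charFun_stochRiemannSum (continuous_ouKernel _ _) t _
  have hid : IdentDistrib (fun ω => X t ω - y) (fun ω' => M (S ω')) P P' :=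
    ⟨hY.aemeasurable, hMS.aemeasurable, hmap⟩
  simpa [Function.comp_def] using hid.comp (measurable_const_add y)

end Kernel

end

/-! ### Assembly of the main theorem -/

theorem mainTheorem8 {N d : ℕ}
    (A : Matrix (Fin N) (Fin N) ℝ) (B : Matrix (Fin N) (Fin d) ℝ)
    (hB : B.rank = d) (hK : KalmanCondition A B)
    (Q : Matrix (Fin d) (Fin d) ℝ) (b : EuclideanSpace ℝ (Fin d))
    (ν : Measure (EuclideanSpace ℝ (Fin d)))
    (α : ℝ) (hα : α ∈ Ioo (0 : ℝ) 2) (hND : ConditionND α ν)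
    {Ω : Type*} [MeasurableSpace Ω] (P : Measure Ω) [IsProbabilityMeasure P]
    (Z : ℝ≥0 → Ω → EuclideanSpace ℝ (Fin d)) (hZ : IsLevyProcessWithTriplet P Z Q b ν)
    (t : ℝ≥0) (ht : 0 < t) (ht' : t ≤ 1) :
    ∃ (Ω' : Type) (_ : MeasurableSpace Ω') (P' : Measure Ω') (_ : IsProbabilityMeasure P')
      (S : ℝ≥0 → Ω' → EuclideanSpace ℝ (Fin N))
      (Q' : Matrix (Fin N) (Fin N) ℝ) (b' : EuclideanSpace ℝ (Fin N))
      (ν' : Measure (EuclideanSpace ℝ (Fin N))),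
      IsLevyProcessWithTriplet P' S Q' b' ν' ∧
      ConditionND α ν' ∧
      ∀ (x : EuclideanSpace ℝ (Fin N)) (X : ℝ≥0 → Ω → EuclideanSpace ℝ (Fin N)),
        IsOUProcess P A B Z x X →
        IdentDistrib (X t)
          (fun ω' => Matrix.toEuclideanLin (NormedSpace.exp ((t : ℝ) • A)) x +
            scalingMap A B t (S t ω')) P P' := by
  have hinj := scalingMap_injective hK (t := t) ht
  -- In finite dimension the injective `M_t` is invertible. Its inverse `T` depends on `t` but not
  -- on `x`, and so does the process built from it.
  let e := LinearEquiv.ofInjectiveEndo (scalingMap A B t).toLinearMap hinj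
  let T : EuclideanSpace ℝ (Fin N) →L[ℝ] EuclideanSpace ℝ (Fin N) :=
    e.symm.toLinearMap.toContinuousLinearMap
  have hMT : ∀ v, scalingMap A B t (T v) = v := fun v => e.apply_symm_apply v
  have hL := continuous_ouKernel (A := A) (B := B) t T
  have hLinj : ∀ r ∈ Icc (0 : ℝ) 1, Function.Injective (ouKernel A B t T r) :=
    fun r _ => ouKernel_injective hB t e.symm.injective r
  have hσ := hZ.isLevyMeasure.sigmaFinite
  obtain ⟨P', hP', ⟨Q', b', hS⟩, hchar⟩ := hZ.exists_mixed hL hLinj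
  exact ⟨_, _, P', hP', _, Q', b', _, hS,
    hND.mixedMeasure hL hα.1 hLinj fun p hp =>
      eq_zero_of_adjoint_ouKernel hK ht e.symm.surjective hp,
    fun x X hX => hX.identDistrib hZ ht hMT (hS.isLevyProcess.measurable t) (hchar t)⟩
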